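/- Work on $\mathbb{R}^3$ with Cartesian coordinates $x^1,x^2,x^3$; subscripts of functions denote partial derivatives, repeated indices are summed from $1$ to $3$, and $\varepsilon^{pqr}$ is the Levi-Civita symbol. For $\varrho,a\in C^\infty(\mathbb{R}^3)$ the Nambu-determinant bi-vector $P(\varrho,[a])$ has the components $P^{ij}=\varrho\,\varepsilon^{kij}a_{x^k}$, that is, $\{f,g\}=P^{ij}f_{x^i}g_{x^j}=\varrho\cdot\det(\partial(a,f,g)/\partial(x^1,x^2,x^3))$. For a bi-vector $P$, a vector field $\vec X$ and a function $H$, the Schouten brackets are $[\![P,\vec X]\!]^{ij}=P^{lj}\partial_lX^i+P^{il}\partial_lX^j-X^l\partial_lP^{ij}$ and $[\![P,H]\!]^i=P^{ij}\partial_jH$. Kontsevich's tetrahedral flow is $\dot P=Q_{\gamma_3}(P)$ with $Q_{\gamma_3}=\Gamma_1-3(\Gamma_2+\Gamma_3)$, where \begin{align*} \Gamma_1^{ij}&=\partial_k\partial_m\partial_pP^{ij}\,\partial_qP^{kl}\,\partial_lP^{mn}\,\partial_nP^{pq},\\ \Gamma_2^{ij}&=\partial_m\partial_pP^{ik}\,\partial_k\partial_qP^{jl}\,\partial_lP^{mn}\,\partial_nP^{pq},\\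 \Gamma_3^{ij}&=\partial_n\partial_pP^{ik}\,\partial_kP^{lm}\,\partial_l\partial_qP^{jn}\,\partial_mP^{pq}. \end{align*} A differential polynomial in $\varrho,a$ is a polynomial with constant real coefficients in $\varrho$, $a$ and their partial derivatives of all orders. Theorem 1. For all $\varrho,a\in C^\infty(\mathbb{R}^3)$ the bi-vector $P(\varrho,[a])$ is Poisson, and the following holds. (1) The tetrahedral flow restricts to the Nambu-determinant bi-vectors: there are differential polynomials $\dot\varrho$ and $\dot a$ in $\varrho,a$ such that $Q_{\gamma_3}(P(\varrho,[a]))=P(\dot\varrho,[a])+P(\varrho,[\dot a])$ for all $\varrho,a$. (2) The restriction is Poisson-cohomology trivial: for all $\varrho,a$, $$8\,Q_{\gamma_3}(P(\varrho,[a]))=[\![P(\varrho,[a]),\vec X]\!]$$ (so $Q_{\gamma_3}(P)=[\![P,\tfrac18\vec X]\!]$), where $\vec X=\sum_{\vec\imath,\vec\jmath,\vec k}\varepsilon^{\vec\imath}\varepsilon^{\vec\jmath}\varepsilon^{\vec k}X_{\vec\imath\vec\jmath\vec k}$, with $\vec\imath=(i_1,i_2,i_3)$, $\vec\jmath=(j_1,j_2,j_3)$,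 $\vec k=(k_1,k_2,k_3)$ and \begin{align*} X_{\vec\imath\vec\jmath\vec k}={}&12\varrho\varrho_{x^{k_2}}\varrho_{x^{i_1}x^{j_1}}a_{x^{k_3}}a_{x^{i_2}x^{j_2}}a_{x^{i_3}x^{j_3}}\,\partial/\partial x^{k_1} +48\varrho\varrho_{x^{j_3}}\varrho_{x^{i_1}x^{j_1}}a_{x^{k_3}}a_{x^{i_2}x^{j_2}}a_{x^{i_3}x^{k_1}}\,\partial/\partial x^{k_2}\\ &+8\varrho_{x^{j_2}}\varrho_{x^{i_1}x^{k_1}}\varrho_{x^{i_2}x^{k_2}}a_{x^{i_3}}a_{x^{j_3}}a_{x^{k_3}}\,\partial/\partial x^{j_1} -40\varrho_{x^{i_3}}\varrho_{x^{j_2}}\varrho_{x^{i_1}x^{k_1}}a_{x^{j_3}}a_{x^{k_3}}a_{x^{i_2}x^{k_2}}\,\partial/\partial x^{j_1}\\ &+8\varrho_{x^{i_3}}\varrho_{x^{j_2}}\varrho_{x^{k_3}}a_{x^{j_3}}a_{x^{i_1}x^{k_1}}a_{x^{i_2}x^{k_2}}\,\partial/\partial x^{j_1} +24\varrho_{x^{j_2}}\varrho_{x^{k_3}}\varrho_{x^{i_1}x^{k_1}}a_{x^{i_3}}a_{x^{j_3}}a_{x^{j_1}x^{k_2}}\,\partial/\partial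 x^{i_2}\\ &-12\varrho^2\varrho_{x^{k_2}}a_{x^{i_1}x^{j_1}}a_{x^{i_2}x^{j_2}}a_{x^{i_3}x^{j_3}x^{k_3}}\,\partial/\partial x^{k_1} +24\varrho\varrho_{x^{j_2}}\varrho_{x^{k_1}}a_{x^{k_2}}a_{x^{i_1}x^{j_1}}a_{x^{i_3}x^{j_3}x^{k_3}}\,\partial/\partial x^{i_2}\\ &-36\varrho\varrho_{x^{i_2}}\varrho_{x^{j_2}}a_{x^{k_2}}a_{x^{i_1}x^{j_1}}a_{x^{i_3}x^{j_3}x^{k_3}}\,\partial/\partial x^{k_1} +8\varrho_{x^{i_2}}\varrho_{x^{j_1}}\varrho_{x^{k_1}}a_{x^{j_2}}a_{x^{k_2}}a_{x^{i_3}x^{j_3}x^{k_3}}\,\partial/\partial x^{i_1}\\ &-8\varrho_{x^{j_1}}\varrho_{x^{k_1}}\varrho_{x^{i_3}x^{j_3}x^{k_3}}a_{x^{i_2}}a_{x^{j_2}}a_{x^{k_2}}\,\partial/\partial x^{i_1}. \end{align*} (3) The trivializing field is unique modulo Hamiltonian fields: let $\vec Y$ be a vector field whose components are differential polynomials in $\varrho,a$,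 homogeneous of degree $3$ in $\varrho$ and its derivatives. Then $8\,Q_{\gamma_3}(P(\varrho,[a]))=[\![P(\varrho,[a]),\vec Y]\!]$ for all $\varrho,a$ if and only if there is a differential polynomial $H$ in $\varrho,a$ with $\vec Y=\vec X+[\![P(\varrho,[a]),H]\!]$ for all $\varrho,a$. -/

import Mathlib

open scoped ContDiff

noncomputable section

/-- Real functions on three-dimensional space with Cartesian coordinates `x 0, x 1, x 2`. -/
abbrev ScalarField : Type := (Fin 3 → ℝ) → ℝ

/-- Vector fields on three-space, given by their components. -/
abbrev VField : Type := Fin 3 → ScalarField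

/-- Contravariant two-tensor fields `∑ i j, P i j • ∂_i ⊗ ∂_j` on three-space, given by their
components; a bi-vector field is such a tensor with `P i j = - P j i`, so that
`{f, g} = ∑ i j, P i j * ∂_i f * ∂_j g`. -/
abbrev TensorField2 : Type := Fin 3 → Fin 3 → ScalarField

/-- The partial derivative along the `i`-th Cartesian coordinate. -/
def pd (i : Fin 3) (f : ScalarField) : ScalarField :=
  fun x => fderiv ℝ f x (Pi.single i 1)

/-- The iterated partial derivative with multi-index `α`. -/
def pdMulti (α : Fin 3 → ℕ) (f : ScalarField) : ScalarField :=
  (pd 0)^[α 0] ((pd 1)^[α 1] ((pd 2)^[α 2] f))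

/-- The Levi-Civita symbol: the sign of `i` if `i` is a permutation of the indices, else zero. -/
def leviCivita (i : Fin 3 → Fin 3) : ℝ :=
  ∑ σ : Equiv.Perm (Fin 3), if (σ : Fin 3 → Fin 3) = i then ((Equiv.Perm.sign σ : ℤ) : ℝ) else 0

/-- The Nambu-determinant bi-vector with density `ϱ` and Casimir `a`:
`{f, g} = ϱ * ∑ k i j, ε^{kij} * ∂_k a * ∂_i f * ∂_j g`. -/
def nambu (ϱ a : ScalarField) : TensorField2 :=
  fun i j x => ϱ x * ∑ k, leviCivita ![k, i, j] * pd k a x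

/-- A tensor is a Poisson bi-vector if it is skew-symmetric and satisfies the Jacobi identity. -/
def IsPoisson (P : TensorField2) : Prop :=
  (∀ i j x, P i j x = - P j i x) ∧
  ∀ i j k x, ∑ l, (P i l x * pd l (P j k) x + P j l x * pd l (P k i) x
    + P k l x * pd l (P i j) x) = 0

/-- The Schouten bracket `⟦P, H⟧` of a bi-vector and a function: the Hamiltonian vector field. -/
def schoutenFun (P : TensorField2) (H : ScalarField) : VField :=
  fun i x => ∑ j, P i j x * pd j H x

/-- The Schouten bracket `⟦P, X⟧` of a bi-vector and a vector field; it equals minus the Lie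
derivative of `P` along `X`. -/
def schoutenVec (P : TensorField2) (X : VField) : TensorField2 :=
  fun i j x => ∑ l, (P l j x * pd l (X i) x + P i l x * pd l (X j) x - X l x * pd l (P i j) x)

/-- The graph `(0,1; 2,4; 2,5; 2,3)`. In such an encoding the vertices `2, 3, 4, 5` carry copies
of `P`, each with its ordered pair of arrows decorated by the two indices of that copy; an arrow
with index `k` acts by `∂_k` on the content of its target; the arrows into the sinks `0` and `1`
carry the free indices `i` and `j`. -/
def graphOne (P : TensorField2) : TensorField2 := fun i j x =>
  ∑ k, ∑ l, ∑ m, ∑ n, ∑ p, ∑ q,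
    pd k (pd m (pd p (P i j))) x * pd q (P k l) x * pd l (P m n) x * pd n (P p q) x

/-- The graph `(0,3; 1,4; 2,5; 2,3)`. -/
def graphTwo (P : TensorField2) : TensorField2 := fun i j x =>
  ∑ k, ∑ l, ∑ m, ∑ n, ∑ p, ∑ q,
    pd m (pd p (P i k)) x * pd k (pd q (P j l)) x * pd l (P m n) x * pd n (P p q) x

/-- The graph `(0,3; 4,5; 1,2; 2,4)`. -/
def graphThree (P : TensorField2) : TensorField2 := fun i j x =>
  ∑ k, ∑ l, ∑ m, ∑ n, ∑ p, ∑ q,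
    pd n (pd p (P i k)) x * pd k (P l m) x * pd l (pd q (P j n)) x * pd m (P p q) x

/-- The right-hand side of Kontsevich's tetrahedral flow, with coefficients `1, -3, -3`. -/
def tetraFlow (P : TensorField2) : TensorField2 :=
  graphOne P - (3 : ℝ) • (graphTwo P + graphThree P)

/-- The two unknown functions of the differential polynomials: the density and the Casimir. -/
inductive Letter : Type
  | rho
  | cas

/-- Differential polynomials in `ϱ` and `a` with real coefficients: polynomials in the jet
variables, where `(u, α)` stands for the partial derivative of `u` with multi-index `α`. -/
abbrev DiffPoly : Type := MvPolynomial (Letter × (Fin 3 → ℕ)) ℝ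

/-- The value of a differential polynomial on a pair of functions. -/
def evalJet (p : DiffPoly) (ϱ a : ScalarField) : ScalarField := fun x =>
  MvPolynomial.eval (fun v : Letter × (Fin 3 → ℕ) =>
    match v.1 with
    | Letter.rho => pdMulti v.2 ϱ x
    | Letter.cas => pdMulti v.2 a x) p

/-- The vector field with given differential-polynomial components, on a pair of functions. -/
def evalJetVec (Y : Fin 3 → DiffPoly) (ϱ a : ScalarField) : VField :=
  fun l => evalJet (Y l) ϱ a

/-- All terms have degree `n` in `ϱ` and its derivatives, counted together. -/
def IsHomogeneousInRho (p : DiffPoly) (n : ℕ) : Prop :=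
  MvPolynomial.IsWeightedHomogeneous (fun v : Letter × (Fin 3 → ℕ) =>
    match v.1 with
    | Letter.rho => (1 : ℕ)
    | Letter.cas => 0) p n

/-- The jet variable `ϱ_{x^{i_1} ... x^{i_n}}` for the list of indices `[i_1, ..., i_n]`. -/
def jr (I : List (Fin 3)) : DiffPoly := MvPolynomial.X (Letter.rho, fun c => I.count c)

/-- The jet variable `a_{x^{i_1} ... x^{i_n}}` for the list of indices `[i_1, ..., i_n]`. -/
def ja (I : List (Fin 3)) : DiffPoly := MvPolynomial.X (Letter.cas, fun c => I.count c)

/-- The vector `p • ∂/∂x^m`. -/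
def along (m : Fin 3) (p : DiffPoly) : Fin 3 → DiffPoly := Pi.single m p

/-- The eleven differential monomials before contraction with the three Levi-Civita symbols. -/
def trivTerm (i j k : Fin 3 → Fin 3) : Fin 3 → DiffPoly :=
  along (k 0) (12 * jr [] * jr [k 1] * jr [i 0, j 0] *
      ja [k 2] * ja [i 1, j 1] * ja [i 2, j 2])
  + along (k 1) (48 * jr [] * jr [j 2] * jr [i 0, j 0] *
      ja [k 2] * ja [i 1, j 1] * ja [i 2, k 0])
  + along (j 0) (8 * jr [j 1] * jr [i 0, k 0] * jr [i 1, k 1] *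
      ja [i 2] * ja [j 2] * ja [k 2])
  - along (j 0) (40 * jr [i 2] * jr [j 1] * jr [i 0, k 0] *
      ja [j 2] * ja [k 2] * ja [i 1, k 1])
  + along (j 0) (8 * jr [i 2] * jr [j 1] * jr [k 2] *
      ja [j 2] * ja [i 0, k 0] * ja [i 1, k 1])
  + along (i 1) (24 * jr [j 1] * jr [k 2] * jr [i 0, k 0] *
      ja [i 2] * ja [j 2] * ja [j 0, k 1])
  - along (k 0) (12 * jr [] ^ 2 * jr [k 1] *
      ja [i 0, j 0] * ja [i 1, j 1] * ja [i 2, j 2, k 2])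
  + along (i 1) (24 * jr [] * jr [j 1] * jr [k 0] *
      ja [k 1] * ja [i 0, j 0] * ja [i 2, j 2, k 2])
  - along (k 0) (36 * jr [] * jr [i 1] * jr [j 1] *
      ja [k 1] * ja [i 0, j 0] * ja [i 2, j 2, k 2])
  + along (i 0) (8 * jr [i 1] * jr [j 0] * jr [k 0] *
      ja [j 1] * ja [k 1] * ja [i 2, j 2, k 2])
  - along (i 0) (8 * jr [j 0] * jr [k 0] * jr [i 2, j 2, k 2] *
      ja [i 1] * ja [j 1] * ja [k 1])

/-- The trivializing vector field `∑ ε^i ε^j ε^k X_{ijk}`, with differential-polynomial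
components. -/
def trivField : Fin 3 → DiffPoly :=
  ∑ i : Fin 3 → Fin 3, ∑ j : Fin 3 → Fin 3, ∑ k : Fin 3 → Fin 3,
    (leviCivita i * leviCivita j * leviCivita k) • trivTerm i j k

end

/-! Finitely many jets at the origin can be prescribed freely, so an identity holding for all smooth
`ϱ, a` is an identity in the polynomial ring of jet variables (`eq_zero_of_evalJet`), and the whole
argument takes place there.

The bracket of `P(ϱ,[a])` with a field `Y` is again of Nambu type to first order
(`schoutenPoly_eq`): the density moves by `ϱ div Y - Y·∇ϱ` and the Casimir by `-∇a·Y`. Hence the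
restriction of the flow follows from the coboundary identity, with one eighth of the velocities
induced by `trivField`. The coboundary identity itself is a finite polynomial identity;
skew-symmetry leaves three components, which are expanded by computation (`KeyPoly.value_defect`).

For uniqueness let `z` be the difference of two trivializing fields. The vanishing of its bracket
makes the gradient of `∇a·z` parallel to `∇a`, which forces `∇a·z = 0` because this polynomial has
positive degree in `ϱ` (`eq_zero_of_totalD_proportional`). What remains is `div (z/ϱ) = 0`, and the
claim becomes `z/ϱ = ∇a × ∇f` (`exists_eq_rhoVar_mul_cross`). Linearizing in `ϱ` turns `z/ϱ` into a
vector of differential operators satisfying the same two equations. There the equations are solved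
by induction on the order: the leading symbol is orthogonal to `∇a` and to the covector `ξ`, hence a
multiple of `∇a × ξ`, and subtracting an exact operator with this symbol lowers the order
(`exists_eq_casCross`). Applying the operators to `ϱ` itself gives back `2 z/ϱ` by Euler's identity,
where `2 = 3 - 1` comes from the degrees of `z` and `ϱ`. The powers of `ϱ` in the denominator of the
potential are removed one at a time, since `ϱ` is a prime of the jet ring (`exists_potential`). -/

noncomputable section

/-! ### Total derivatives of differential polynomials -/

/-- The total derivative along the `i`-th coordinate. -/
def totalD (i : Fin 3) : Derivation ℝ DiffPoly DiffPoly :=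
  MvPolynomial.mkDerivation ℝ fun v => MvPolynomial.X (v.1, v.2 + Pi.single i 1)

@[simp]
lemma totalD_X (i : Fin 3) (v : Letter × (Fin 3 → ℕ)) :
    totalD i (MvPolynomial.X v) = MvPolynomial.X (v.1, v.2 + Pi.single i 1) :=
  MvPolynomial.mkDerivation_X ..

@[simp]
lemma totalD_C (i : Fin 3) (c : ℝ) : totalD i (MvPolynomial.C c) = 0 :=
  MvPolynomial.derivation_C ..

lemma totalD_comm (i j : Fin 3) (p : DiffPoly) :
    totalD i (totalD j p) = totalD j (totalD i p) := by
  induction p using MvPolynomial.induction_on with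
  | C c => simp
  | add p q hp hq => simp [hp, hq]
  | mul_X p v hp => simp [hp, add_right_comm]; ring

/-! ### Partial derivatives of smooth functions -/

lemma contDiff_pd {f : ScalarField} (hf : ContDiff ℝ ∞ f) (i : Fin 3) :
    ContDiff ℝ ∞ (pd i f) := by
  unfold pd
  exact (hf.fderiv_right (m := ∞) (by simp)).clm_apply contDiff_const

lemma pd_comm {f : ScalarField} (hf : ContDiff ℝ ∞ f) (i j : Fin 3) :
    pd i (pd j f) = pd j (pd i f) := by
  have key : ∀ (i j : Fin 3) (x : Fin 3 → ℝ), pd i (pd j f) x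
      = fderiv ℝ (fderiv ℝ f) x (Pi.single i 1) (Pi.single j 1) := by
    intro i j x
    have h : DifferentiableAt ℝ (fderiv ℝ f) x :=
      (hf.fderiv_right (m := ∞) (by simp)).differentiable (by simp) x
    have e : pd j f = fun y => fderiv ℝ f y (Pi.single j 1) := rfl
    rw [pd, e, fderiv_clm_apply h (differentiableAt_const _)]
    simp
  ext x
  rw [key, key]
  exact hf.contDiffAt.isSymmSndFDerivAt (by
    rw [minSmoothness_of_isRCLikeNormedField]
    exact WithTop.coe_le_coe.2 (le_top : (2 : ℕ∞) ≤ ⊤)) _ _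

lemma contDiff_pd_iterate {f : ScalarField} (hf : ContDiff ℝ ∞ f) (i : Fin 3) (n : ℕ) :
    ContDiff ℝ ∞ ((pd i)^[n] f) := by
  induction n generalizing f with
  | zero => exact hf
  | succ n ih => exact ih (contDiff_pd hf i)

lemma pd_iterate_comm {f : ScalarField} (hf : ContDiff ℝ ∞ f) (i j : Fin 3) (n : ℕ) :
    pd i ((pd j)^[n] f) = (pd j)^[n] (pd i f) := by
  induction n generalizing f with
  | zero => rfl
  | succ n ih =>
    rw [Function.iterate_succ_apply, Function.iterate_succ_apply, ih (contDiff_pd hf j),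
      pd_comm hf]

lemma contDiff_pdMulti {f : ScalarField} (hf : ContDiff ℝ ∞ f) (α : Fin 3 → ℕ) :
    ContDiff ℝ ∞ (pdMulti α f) :=
  contDiff_pd_iterate (contDiff_pd_iterate (contDiff_pd_iterate hf _ _) _ _) _ _

@[simp]
lemma pdMulti_zero (f : ScalarField) : pdMulti 0 f = f := rfl

lemma pd_pdMulti {f : ScalarField} (hf : ContDiff ℝ ∞ f) (i : Fin 3) (α : Fin 3 → ℕ) :
    pd i (pdMulti α f) = pdMulti (α + Pi.single i 1) f := by
  have h2 := contDiff_pd_iterate hf 2 (α 2)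
  have h1 := contDiff_pd_iterate h2 1 (α 1)
  fin_cases i
  · simp [pdMulti, Function.iterate_succ_apply']
  · simp [pdMulti, pd_iterate_comm h1, pd_iterate_comm h2, Function.iterate_succ_apply]
  · simp [pdMulti, pd_iterate_comm h1, pd_iterate_comm h2, pd_iterate_comm hf,
      Function.iterate_succ_apply]

/-! ### Evaluation of differential polynomials -/

/-- The jet of a pair of functions at a point. -/
def jetAt (ϱ a : ScalarField) (x : Fin 3 → ℝ) (v : Letter × (Fin 3 → ℕ)) : ℝ :=
  match v.1 with
  | Letter.rho => pdMulti v.2 ϱ x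
  | Letter.cas => pdMulti v.2 a x

lemma evalJet_apply (p : DiffPoly) (ϱ a : ScalarField) (x : Fin 3 → ℝ) :
    evalJet p ϱ a x = MvPolynomial.eval (jetAt ϱ a x) p := rfl

lemma evalJet_C (c : ℝ) (ϱ a : ScalarField) :
    evalJet (MvPolynomial.C c) ϱ a = fun _ => c := by
  ext x; simp [evalJet_apply]

lemma evalJet_rho (α : Fin 3 → ℕ) (ϱ a : ScalarField) :
    evalJet (MvPolynomial.X (Letter.rho, α)) ϱ a = pdMulti α ϱ := by
  ext x; simp [evalJet_apply, jetAt]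

lemma evalJet_cas (α : Fin 3 → ℕ) (ϱ a : ScalarField) :
    evalJet (MvPolynomial.X (Letter.cas, α)) ϱ a = pdMulti α a := by
  ext x; simp [evalJet_apply, jetAt]

@[simp]
lemma evalJet_add (p q : DiffPoly) (ϱ a : ScalarField) :
    evalJet (p + q) ϱ a = evalJet p ϱ a + evalJet q ϱ a := by
  ext x; simp [evalJet_apply]

@[simp]
lemma evalJet_sub (p q : DiffPoly) (ϱ a : ScalarField) :
    evalJet (p - q) ϱ a = evalJet p ϱ a - evalJet q ϱ a := by
  ext x; simp [evalJet_apply]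

@[simp]
lemma evalJet_mul (p q : DiffPoly) (ϱ a : ScalarField) :
    evalJet (p * q) ϱ a = evalJet p ϱ a * evalJet q ϱ a := by
  ext x; simp [evalJet_apply]

lemma evalJet_sum {ι : Type*} (s : Finset ι) (p : ι → DiffPoly) (ϱ a : ScalarField)
    (x : Fin 3 → ℝ) :
    evalJet (∑ i ∈ s, p i) ϱ a x = ∑ i ∈ s, evalJet (p i) ϱ a x := by
  simp [evalJet_apply]

lemma contDiff_evalJet {ϱ a : ScalarField} (hϱ : ContDiff ℝ ∞ ϱ) (ha : ContDiff ℝ ∞ a)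
    (p : DiffPoly) : ContDiff ℝ ∞ (evalJet p ϱ a) := by
  induction p using MvPolynomial.induction_on with
  | C c => rw [evalJet_C]; exact contDiff_const
  | add p q hp hq => rw [evalJet_add]; exact hp.add hq
  | mul_X p v hp =>
    rw [evalJet_mul]
    refine hp.mul ?_
    obtain ⟨_ | _, α⟩ := v
    · rw [evalJet_rho]; exact contDiff_pdMulti hϱ α
    · rw [evalJet_cas]; exact contDiff_pdMulti ha α

/-- The bridge from analysis to algebra: both sides obey the Leibniz rule and agree on jet
variables. -/
lemma pd_evalJet {ϱ a : ScalarField} (hϱ : ContDiff ℝ ∞ ϱ) (ha : ContDiff ℝ ∞ a)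
    (i : Fin 3) (p : DiffPoly) : pd i (evalJet p ϱ a) = evalJet (totalD i p) ϱ a := by
  have hd (p : DiffPoly) (x) : DifferentiableAt ℝ (evalJet p ϱ a) x :=
    (contDiff_evalJet hϱ ha p).differentiable (by simp) x
  induction p using MvPolynomial.induction_on with
  | C c =>
    ext x
    rw [evalJet_C]
    simp [pd, evalJet_apply]
  | add p q hp hq =>
    rw [evalJet_add, map_add, evalJet_add, ← hp, ← hq]
    ext x
    simp [pd, fderiv_add (hd p x) (hd q x)]
  | mul_X p v hp =>
    have hX : pd i (evalJet (MvPolynomial.X v) ϱ a)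
        = evalJet (totalD i (MvPolynomial.X v)) ϱ a := by
      rw [totalD_X]
      obtain ⟨_ | _, α⟩ := v
      · rw [evalJet_rho, evalJet_rho, pd_pdMulti hϱ]
      · rw [evalJet_cas, evalJet_cas, pd_pdMulti ha]
    rw [Derivation.leibniz, evalJet_mul, evalJet_add, smul_eq_mul, smul_eq_mul, evalJet_mul,
      evalJet_mul, ← hX, ← hp]
    ext x
    simp [pd, fderiv_mul (hd p x) (hd _ x)]

/-! ### Prescribing jets at the origin -/

/-- Polynomial functions as scalar fields. -/
def polyField (p : MvPolynomial (Fin 3) ℝ) : ScalarField := fun x => MvPolynomial.eval x p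

lemma contDiff_polyField (p : MvPolynomial (Fin 3) ℝ) : ContDiff ℝ ∞ (polyField p) := by
  unfold polyField
  induction p using MvPolynomial.induction_on with
  | C c => simpa using contDiff_const
  | add p q hp hq => simpa using hp.add hq
  | mul_X p v hp => simpa using hp.mul (contDiff_apply ℝ ℝ v)

lemma pd_polyField (i : Fin 3) (p : MvPolynomial (Fin 3) ℝ) :
    pd i (polyField p) = polyField (MvPolynomial.pderiv i p) := by
  have hd (p : MvPolynomial (Fin 3) ℝ) (x) : DifferentiableAt ℝ (polyField p) x :=
    (contDiff_polyField p).differentiable (by simp) x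
  induction p using MvPolynomial.induction_on with
  | C c =>
    have : polyField (MvPolynomial.C c) = fun _ => c := by ext; simp [polyField]
    ext x
    rw [this]
    simp [pd, polyField]
  | add p q hp hq =>
    have h (p q) : polyField (p + q) = polyField p + polyField q := by ext; simp [polyField]
    rw [h, map_add, h, ← hp, ← hq]
    ext x
    simp [pd, fderiv_add (hd p x) (hd q x)]
  | mul_X p v hp =>
    ext x
    have h : polyField (p * MvPolynomial.X v) = polyField p * polyField (MvPolynomial.X v) := by
      ext; simp [polyField]
    have hX : pd i (polyField (MvPolynomial.X v)) x = (Pi.single i 1 : Fin 3 → ℝ) v := by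
      have : polyField (MvPolynomial.X v) = fun x => x v := by ext; simp [polyField]
      rw [this]
      simp [pd, fderiv_apply]
    have hp' := congrFun hp x
    simp only [pd] at hp' hX ⊢
    rw [h, fderiv_mul (hd p x) (hd _ x)]
    simp only [add_apply, smul_apply, hX, hp', smul_eq_mul]
    by_cases hiv : v = i
    · subst hiv; simp [polyField]
    · simp [polyField, MvPolynomial.pderiv_X, hiv]

/-- Each derivative brings down the current exponent of `X i`; ending at exponent zero, these
exponents multiply to `n!`. -/
lemma coeff_pderiv_iterate (i : Fin 3) (n : ℕ) (p : MvPolynomial (Fin 3) ℝ) (m : Fin 3 →₀ ℕ)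
    (hm : m i = 0) :
    MvPolynomial.coeff m ((MvPolynomial.pderiv i)^[n] p)
      = MvPolynomial.coeff (m + Finsupp.single i n) p * n.factorial := by
  induction n generalizing p with
  | zero => simp
  | succ n ih =>
    rw [Function.iterate_succ_apply, ih, MvPolynomial.coeff_pderiv, Nat.factorial_succ]
    simp only [Finsupp.add_apply, hm, Finsupp.single_eq_same, add_assoc, ← Finsupp.single_add]
    push_cast
    ring

lemma pdMulti_polyField_zero (α : Fin 3 → ℕ) (p : MvPolynomial (Fin 3) ℝ) :
    pdMulti α (polyField p) 0 = MvPolynomial.coeff (Finsupp.equivFunOnFinite.symm α) p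
      * ((α 0).factorial * (α 1).factorial * (α 2).factorial) := by
  have h (i : Fin 3) (n : ℕ) (p) :
      (pd i)^[n] (polyField p) = polyField ((MvPolynomial.pderiv i)^[n] p) := by
    induction n generalizing p with
    | zero => rfl
    | succ n ih => rw [Function.iterate_succ_apply, Function.iterate_succ_apply, pd_polyField, ih]
  have hα : (0 + Finsupp.single 0 (α 0) + Finsupp.single 1 (α 1) + Finsupp.single 2 (α 2)
      : Fin 3 →₀ ℕ) = Finsupp.equivFunOnFinite.symm α := by
    ext i; fin_cases i <;> simp
  rw [pdMulti, h, h, h, polyField, show (0 : Fin 3 → ℝ) = fun _ => 0 from rfl,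
    MvPolynomial.eval_zero', MvPolynomial.constantCoeff_eq,
    coeff_pderiv_iterate _ _ _ _ (by simp), coeff_pderiv_iterate _ _ _ _ (by simp),
    coeff_pderiv_iterate _ _ _ _ (by simp), hα]
  ring

/-- A scalar field with finitely many prescribed Taylor coefficients at the origin. -/
lemma exists_prescribed_jet (S : Finset (Fin 3 → ℕ)) (c : (Fin 3 → ℕ) → ℝ) :
    ∃ f : ScalarField, ContDiff ℝ ∞ f ∧ ∀ α ∈ S, pdMulti α f 0 = c α := by
  classical
  refine ⟨polyField (∑ α ∈ S, MvPolynomial.monomial (Finsupp.equivFunOnFinite.symm α)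
    (c α / ((α 0).factorial * (α 1).factorial * (α 2).factorial))), contDiff_polyField _, ?_⟩
  intro α hα
  rw [pdMulti_polyField_zero, MvPolynomial.coeff_sum, Finset.sum_eq_single α]
  · rw [MvPolynomial.coeff_monomial, if_pos rfl]
    field_simp
  · intro β _ hβ
    rw [MvPolynomial.coeff_monomial, if_neg]
    simpa using hβ
  · exact fun h => absurd hα h

/-- A differential polynomial which vanishes on all pairs of smooth functions is zero. -/
theorem eq_zero_of_evalJet (p : DiffPoly)
    (h : ∀ ϱ a : ScalarField, ContDiff ℝ ∞ ϱ → ContDiff ℝ ∞ a → evalJet p ϱ a = 0) : p = 0 := by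
  classical
  -- Over the infinite field `ℝ` it suffices to vanish at every assignment `y` of the jet variables,
  -- and only the finitely many variables occurring in `p` have to be realized by functions.
  refine MvPolynomial.funext fun y => ?_
  obtain ⟨ϱ, hϱ, h1⟩ := exists_prescribed_jet (p.vars.image Prod.snd)
    fun α => y (Letter.rho, α)
  obtain ⟨a, ha, h2⟩ := exists_prescribed_jet (p.vars.image Prod.snd)
    fun α => y (Letter.cas, α)
  have h3 := congrFun (h ϱ a hϱ ha) 0
  rw [evalJet_apply] at h3
  rw [map_zero, ← Pi.zero_apply (M := fun _ => ℝ) (0 : Fin 3 → ℝ), ← h3]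
  refine MvPolynomial.eval₂Hom_congr' rfl (fun v hv _ => ?_) rfl
  have hv' : v.2 ∈ p.vars.image Prod.snd := Finset.mem_image_of_mem _ hv
  obtain ⟨_ | _, α⟩ := v
  · exact (h1 α hv').symm
  · exact (h2 α hv').symm
open MvPolynomial
/-- The undifferentiated density as a jet variable. -/
def rhoVar : DiffPoly := X (Letter.rho, 0)

/-- The undifferentiated Casimir as a jet variable. -/
def casVar : DiffPoly := X (Letter.cas, 0)

/-! ### Symbols: polynomials in three covariables over differential polynomials -/

/-- Differential operators with differential-polynomial coefficients, as polynomials in the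
covariables; the monomial with exponents `α` stands for the derivative of multi-index `α`. -/
abbrev SymbolRing : Type := MvPolynomial (Fin 3) DiffPoly

/-- The total derivative acting on coefficients. -/
def coeffD (i : Fin 3) (t : SymbolRing) : SymbolRing :=
  ∑ m ∈ t.support, monomial m (totalD i (coeff m t))

lemma coeff_coeffD (i : Fin 3) (t : SymbolRing) (m : Fin 3 →₀ ℕ) :
    coeff m (coeffD i t) = totalD i (coeff m t) := by
  classical
  simp only [coeffD, coeff_sum, coeff_monomial, Finset.sum_ite_eq', mem_support_iff]
  split_ifs with h
  · rfl
  · rw [not_not] at h; rw [h, map_zero]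

lemma coeffD_add (i : Fin 3) (s t : SymbolRing) : coeffD i (s + t) = coeffD i s + coeffD i t := by
  ext1 m; simp [coeff_coeffD]

lemma coeffD_sub (i : Fin 3) (s t : SymbolRing) : coeffD i (s - t) = coeffD i s - coeffD i t := by
  ext1 m; simp [coeff_coeffD]

lemma coeffD_C_mul (i : Fin 3) (p : DiffPoly) (t : SymbolRing) :
    coeffD i (C p * t) = C (totalD i p) * t + C p * coeffD i t := by
  ext1 m; simp [coeff_coeffD]; ring

lemma coeffD_X_mul (i j : Fin 3) (t : SymbolRing) :
    coeffD i (X j * t) = X j * coeffD i t := by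
  classical
  ext1 m; simp only [coeff_coeffD, coeff_X_mul']; split_ifs <;> simp

lemma coeffD_comm (i j : Fin 3) (t : SymbolRing) :
    coeffD i (coeffD j t) = coeffD j (coeffD i t) := by
  ext1 m; simp [coeff_coeffD, totalD_comm i j]

lemma homogeneousComponent_coeffD (n : ℕ) (i : Fin 3) (t : SymbolRing) :
    homogeneousComponent n (coeffD i t) = coeffD i (homogeneousComponent n t) := by
  classical
  ext1 m
  simp only [coeff_coeffD, coeff_homogeneousComponent]
  split_ifs <;> simp

@[simp]
lemma coeffD_zero (i : Fin 3) : coeffD i 0 = 0 := by simp [coeffD]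

lemma homogeneousComponent_succ_X_mul {R : Type*} [CommSemiring R] {σ : Type*} (n : ℕ) (j : σ)
    (t : MvPolynomial σ R) :
    homogeneousComponent (n + 1) (X j * t) = X j * homogeneousComponent n t := by
  classical
  ext m
  simp only [coeff_homogeneousComponent, coeff_X_mul']
  by_cases hj : j ∈ m.support
  · have hm : m = (m - Finsupp.single j 1) + Finsupp.single j 1 := by
      rw [tsub_add_cancel_of_le]
      simpa [Nat.one_le_iff_ne_zero] using hj
    have hd : m.degree = (m - Finsupp.single j 1).degree + 1 := by
      conv_lhs => rw [hm]
      simp [map_add]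
    simp [hj, hd]
  · simp [hj]

lemma homogeneousComponent_zero_X_mul {R : Type*} [CommSemiring R] {σ : Type*} (j : σ)
    (t : MvPolynomial σ R) : homogeneousComponent 0 (X j * t) = 0 := by
  classical
  simp [homogeneousComponent_zero, coeff_X_mul']

/-- The total derivative of an operator composed on the left with a partial derivative. -/
def nabla (i : Fin 3) (t : SymbolRing) : SymbolRing := coeffD i t + X i * t

lemma nabla_add (i : Fin 3) (s t : SymbolRing) : nabla i (s + t) = nabla i s + nabla i t := by
  simp only [nabla, coeffD_add]; ring

lemma nabla_sub (i : Fin 3) (s t : SymbolRing) : nabla i (s - t) = nabla i s - nabla i t := by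
  simp only [nabla, coeffD_sub]; ring

lemma nabla_C_mul (i : Fin 3) (p : DiffPoly) (t : SymbolRing) :
    nabla i (C p * t) = C (totalD i p) * t + C p * nabla i t := by
  simp only [nabla, coeffD_C_mul]; ring

lemma nabla_comm (i j : Fin 3) (t : SymbolRing) :
    nabla i (nabla j t) = nabla j (nabla i t) := by
  simp only [nabla, coeffD_add, coeffD_X_mul, coeffD_comm i j]; ring

/-- The linearization of a differential polynomial with respect to `ϱ`. -/
def linearize : Derivation ℝ DiffPoly SymbolRing :=
  mkDerivation ℝ fun v => match v.1 with
    | Letter.rho => monomial (Finsupp.equivFunOnFinite.symm v.2) 1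
    | Letter.cas => 0

lemma linearize_rho (α : Fin 3 → ℕ) :
    linearize (X (Letter.rho, α)) = monomial (Finsupp.equivFunOnFinite.symm α) 1 :=
  mkDerivation_X ..

lemma linearize_cas (α : Fin 3 → ℕ) : linearize (X (Letter.cas, α)) = 0 :=
  mkDerivation_X ..

lemma equivFunOnFinite_symm_add_single (α : Fin 3 → ℕ) (i : Fin 3) :
    Finsupp.equivFunOnFinite.symm (α + Pi.single i 1)
      = Finsupp.single i 1 + Finsupp.equivFunOnFinite.symm α := by
  classical
  ext j
  simp [Finsupp.single_apply, Pi.single_apply, eq_comm, add_comm]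

lemma coeffD_monomial_one (i : Fin 3) (m : Fin 3 →₀ ℕ) :
    coeffD i (monomial m 1) = 0 := by
  classical
  ext1 n
  simp only [coeff_coeffD, coeff_monomial]
  split_ifs <;> simp

/-- Varying `ϱ` commutes with differentiating in space, and `nabla i` is composition with `∂_i` on
the left. -/
lemma linearize_totalD (i : Fin 3) (p : DiffPoly) :
    linearize (totalD i p) = nabla i (linearize p) := by
  induction p using MvPolynomial.induction_on with
  | C c => simp [nabla, derivation_C]
  | add p q hp hq => simp [hp, hq, nabla_add]
  | mul_X p v hp =>
    have hX : linearize (totalD i (X v)) = nabla i (linearize (X v)) := by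
      rw [totalD_X]
      obtain ⟨_ | _, α⟩ := v
      · rw [linearize_rho, linearize_rho, nabla, coeffD_monomial_one, zero_add,
          equivFunOnFinite_symm_add_single, X, monomial_mul, one_mul]
      · simp [linearize_cas, nabla]
    simp only [Derivation.leibniz, map_add, hp, hX, smul_eq_mul,
      MvPolynomial.smul_eq_C_mul, nabla_add, nabla_C_mul]
    ring

/-- Application of an operator to `ϱ`. -/
def applyRho : SymbolRing →ₗ[DiffPoly] DiffPoly :=
  (basisMonomials (Fin 3) DiffPoly).constr DiffPoly
    fun m => X (Letter.rho, Finsupp.equivFunOnFinite m)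

lemma applyRho_monomial (m : Fin 3 →₀ ℕ) (p : DiffPoly) :
    applyRho (monomial m p) = p * X (Letter.rho, ⇑m) := by
  have h : monomial m p = p • (basisMonomials (Fin 3) DiffPoly) m := by
    simp [smul_monomial]
  rw [h, map_smul, applyRho, Module.Basis.constr_basis, smul_eq_mul]
  rfl

lemma applyRho_C_mul (p : DiffPoly) (t : SymbolRing) :
    applyRho (C p * t) = p * applyRho t := by
  rw [← MvPolynomial.smul_eq_C_mul, map_smul, smul_eq_mul]

lemma coeffD_monomial (i : Fin 3) (m : Fin 3 →₀ ℕ) (p : DiffPoly) :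
    coeffD i (monomial m p) = monomial m (totalD i p) := by
  classical
  ext1 n
  simp only [coeff_coeffD, coeff_monomial]
  split_ifs <;> simp

/-- The Leibniz rule: `coeffD i` differentiates the coefficients and `X i` differentiates the
argument `ϱ`. -/
lemma applyRho_nabla (i : Fin 3) (t : SymbolRing) :
    applyRho (nabla i t) = totalD i (applyRho t) := by
  induction t using MvPolynomial.induction_on' with
  | monomial m p =>
    have h : X (R := DiffPoly) i * monomial m p = monomial (Finsupp.single i 1 + m) p := by
      rw [X, monomial_mul, one_mul]
    have h2 : ⇑(Finsupp.single i 1 + m : Fin 3 →₀ ℕ) = ⇑m + Pi.single i 1 := by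
      classical
      ext j; simp [Finsupp.single_apply, Pi.single_apply, eq_comm, add_comm]
    rw [nabla, coeffD_monomial, h, map_add, applyRho_monomial, applyRho_monomial,
      applyRho_monomial, h2, Derivation.leibniz, totalD_X, smul_eq_mul, smul_eq_mul]
    ring
  | add s t hs ht => rw [nabla_add, map_add, map_add, map_add, hs, ht]

/-- The weight of a jet variable that counts the occurrences of `ϱ`. -/
def rhoWeight (v : Letter × (Fin 3 → ℕ)) : ℕ :=
  match v.1 with
  | Letter.rho => 1
  | Letter.cas => 0

lemma isHomogeneousInRho_iff {p : DiffPoly} {n : ℕ} :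
    IsHomogeneousInRho p n ↔ IsWeightedHomogeneous rhoWeight p n := Iff.rfl

/-- Euler's identity for the degree in `ϱ`. -/
lemma applyRho_linearize {p : DiffPoly} {n : ℕ} (hp : IsHomogeneousInRho p n) :
    applyRho (linearize p) = n * p := by
  classical
  have key (s : Letter × (Fin 3 → ℕ) →₀ ℕ) (c : ℝ) :
      applyRho (linearize (monomial s c)) = (Finsupp.weight rhoWeight s : ℕ) * monomial s c := by
    induction s using Finsupp.induction_linear generalizing c with
    | zero => simp [derivation_C]
    | add s t hs ht =>
      have h : monomial (s + t) c = monomial s c * monomial t (1 : ℝ) := by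
        rw [monomial_mul, mul_one]
      rw [h, Derivation.leibniz, map_add, map_smul, map_smul, hs, ht, map_add]
      push_cast
      simp only [smul_eq_mul]
      ring
    | single v k =>
      have h : monomial (Finsupp.single v k) c = C c * X v ^ k := by
        rw [C_mul_X_pow_eq_monomial]
      have hX : applyRho (linearize (X v)) = (rhoWeight v : DiffPoly) * X v := by
        obtain ⟨_ | _, α⟩ := v
        · rw [linearize_rho, applyRho_monomial]; simp [rhoWeight]
        · rw [linearize_cas]; simp [rhoWeight]
      rw [h, Derivation.leibniz, derivation_C, smul_zero, add_zero, Derivation.leibniz_pow]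
      simp only [map_smul, map_nsmul]
      rw [hX, Finsupp.weight_single]
      cases k with
      | zero => simp
      | succ k =>
        simp only [smul_eq_mul, nsmul_eq_mul, Nat.cast_mul]
        rw [Nat.add_sub_cancel, pow_succ]
        ring
  rw [p.as_sum, map_sum, map_sum, Finset.mul_sum]
  refine Finset.sum_congr rfl fun s hs => ?_
  rw [key, isHomogeneousInRho_iff.1 hp (mem_support_iff.1 hs)]

/-! ### Leading symbols and division by the cross product of `∇a` with the covector -/

/-- The first derivatives of the Casimir. -/
def casGrad (i : Fin 3) : DiffPoly := X (Letter.cas, Pi.single i 1)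

lemma totalD_casVar (i : Fin 3) : totalD i casVar = casGrad i := by
  simp [casVar, casGrad]

/-- The first derivatives of the density. -/
def rhoGrad (i : Fin 3) : DiffPoly := X (Letter.rho, Pi.single i 1)

lemma totalD_rhoVar (i : Fin 3) : totalD i rhoVar = rhoGrad i := by
  simp [rhoVar, rhoGrad]

lemma totalD_casGrad_comm (i j : Fin 3) : totalD i (casGrad j) = totalD j (casGrad i) := by
  rw [← totalD_casVar, ← totalD_casVar, totalD_comm]

lemma totalD_rhoGrad_comm (i j : Fin 3) : totalD i (rhoGrad j) = totalD j (rhoGrad i) := by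
  rw [← totalD_rhoVar, ← totalD_rhoVar, totalD_comm]

lemma linearize_casGrad (i : Fin 3) : linearize (casGrad i) = 0 := linearize_cas _

lemma single_ne_single {i j : Fin 3} (h : i ≠ j) :
    (Pi.single i 1 : Fin 3 → ℕ) ≠ Pi.single j 1 := by
  intro e
  have := congrFun e i
  simp [h] at this

/-- Evaluation of a symbol at numerical jets and covariables. -/
def symbolEval (y : Letter × (Fin 3 → ℕ) → ℝ) (ξ : Fin 3 → ℝ) : SymbolRing →+* ℝ :=
  eval₂Hom (eval y) ξ

/-- The polynomial has degree one in `X 2`, and its leading coefficient is a prime not dividing the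
constant term. The latter is seen by setting `a_y = 0` and all other variables to `1`. -/
lemma irreducible_cross :
    Irreducible (C (casGrad 1) * X 2 + -(C (casGrad 2) * X 1) : SymbolRing) := by
  classical
  have hp : Prime (C (casGrad 1) : SymbolRing) := (prime_C_iff _).2 (X_prime)
  refine irreducible_mul_X_add _ _ _ hp.ne_zero (by simp) ?_ ?_
  · rw [vars_neg]
    intro h
    have := vars_mul _ _ h
    simp [vars_C, vars_X] at this
  · rw [hp.irreducible.isRelPrime_iff_not_dvd]
    intro h
    have h1 := map_dvd (symbolEval
      (fun v => if v = (Letter.cas, Pi.single 1 1) then 0 else 1) fun _ => 1) h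
    simp [symbolEval, casGrad, single_ne_single] at h1

/-- A symbol-valued vector orthogonal to the covector and to the gradient of the Casimir is
proportional to their cross product. -/
lemma exists_eq_mul_cross (s : Fin 3 → SymbolRing)
    (h1 : C (casGrad 0) * s 0 + C (casGrad 1) * s 1 + C (casGrad 2) * s 2 = 0)
    (h2 : X 0 * s 0 + X 1 * s 1 + X 2 * s 2 = 0) :
    ∃ h, s 0 = C (casGrad 1) * (X 2 * h) - C (casGrad 2) * (X 1 * h)
      ∧ s 1 = C (casGrad 2) * (X 0 * h) - C (casGrad 0) * (X 2 * h)
      ∧ s 2 = C (casGrad 0) * (X 1 * h) - C (casGrad 1) * (X 0 * h) := by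
  set c0 : SymbolRing := C (casGrad 1) * X 2 + -(C (casGrad 2) * X 1) with hc0
  set c1 : SymbolRing := C (casGrad 2) * X 0 - C (casGrad 0) * X 2 with hc1
  set c2 : SymbolRing := C (casGrad 0) * X 1 - C (casGrad 1) * X 0 with hc2
  have hp : Prime c0 := irreducible_cross.prime
  -- Both `s` and `c = ∇a × ξ` are orthogonal to `∇a` and `ξ`, so `s × c = 0`. As `c0` is prime and
  -- does not divide `c1`, it divides `s 0`.
  have e1 : s 0 * c1 = c0 * s 1 := by
    rw [hc0, hc1]; linear_combination X 2 * -h1 + C (casGrad 2) * h2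
  have e2 : s 0 * c2 = c0 * s 2 := by
    rw [hc0, hc2]; linear_combination X 1 * h1 - C (casGrad 1) * h2
  have hn : ¬ c0 ∣ c1 := by
    intro h
    have h3 := map_dvd (symbolEval (fun _ => 1) ![1, 0, 0]) h
    simp [symbolEval, casGrad, hc0, hc1] at h3
  obtain ⟨h, hh⟩ := (hp.dvd_or_dvd (Dvd.intro _ e1.symm)).resolve_right hn
  refine ⟨h, by rw [hh, hc0]; ring, ?_, ?_⟩
  · apply mul_left_cancel₀ hp.ne_zero
    rw [← e1, hh, hc1]; ring
  · apply mul_left_cancel₀ hp.ne_zero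
    rw [← e2, hh, hc2]; ring

lemma eq_zero_of_homogeneousComponent {t : SymbolRing}
    (h : ∀ k, homogeneousComponent k t = 0) : t = 0 := by
  rw [← sum_homogeneousComponent t]
  exact Finset.sum_eq_zero fun k _ => h k

lemma exists_homogeneousComponent_eq_zero (s : Fin 3 → SymbolRing) :
    ∃ n, ∀ k, n ≤ k → ∀ i, homogeneousComponent k (s i) = 0 := by
  refine ⟨∑ i, (s i).totalDegree + 1, fun k hk i => homogeneousComponent_eq_zero _ _ ?_⟩
  have := Finset.single_le_sum (f := fun i => (s i).totalDegree) (fun _ _ => Nat.zero_le _)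
    (Finset.mem_univ i)
  omega

/-- Differentiating coefficients does not raise the order, so the leading symbol of `∂_i ∘ t` is `X
i` times that of `t`. -/
lemma homogeneousComponent_succ_nabla {n : ℕ} {t : SymbolRing} (i : Fin 3)
    (h : homogeneousComponent (n + 1) t = 0) :
    homogeneousComponent (n + 1) (nabla i t) = X i * homogeneousComponent n t := by
  rw [nabla, map_add, homogeneousComponent_coeffD, h, coeffD_zero, zero_add,
    homogeneousComponent_succ_X_mul]

/-! ### Exactness of the leafwise complex on differential operators -/

/-- The Casimir-tangent part of the covariant gradient of `h / ϱ ^ m`, times `ϱ ^ (m + 1)`. -/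
def twistedGrad (m : ℕ) (h : SymbolRing) (i : Fin 3) : SymbolRing :=
  C rhoVar * nabla i h - C (m * rhoGrad i) * h

/-- Cross product of the gradient of the Casimir with a symbol-valued vector. -/
def casCross (u : Fin 3 → SymbolRing) : Fin 3 → SymbolRing :=
  ![C (casGrad 1) * u 2 - C (casGrad 2) * u 1,
    C (casGrad 2) * u 0 - C (casGrad 0) * u 2,
    C (casGrad 0) * u 1 - C (casGrad 1) * u 0]

lemma casCross_orthogonal (u : Fin 3 → SymbolRing) :
    ∑ i, C (casGrad i) * casCross u i = 0 := by
  simp [Fin.sum_univ_three, casCross]; ring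

/-- This is `div (∇a × ∇g) = 0` for `g = h / ϱ ^ m`, cleared of denominators: the cross product in
the statement is `ϱ ^ (m + 1)` times `∇a × ∇g`. -/
lemma divergence_casCross_twistedGrad (m : ℕ) (h : SymbolRing) :
    C rhoVar * ∑ i, nabla i (casCross (twistedGrad m h) i)
      = C ((m + 1 : ℕ) : DiffPoly) *
        ∑ i, C (rhoGrad i) * casCross (twistedGrad m h) i := by
  have hm : ∀ i, totalD i (m : DiffPoly) = 0 := fun i => Derivation.map_natCast _ _
  simp only [Fin.sum_univ_three, casCross, twistedGrad, Matrix.cons_val_zero, Matrix.cons_val_one,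
    Matrix.cons_val, nabla_sub, nabla_C_mul, totalD_rhoVar, Derivation.leibniz, hm,
    smul_eq_mul]
  simp only [C_mul, mul_zero, add_zero, nabla_comm 1 0,
    nabla_comm 2 0, nabla_comm 2 1,
    totalD_casGrad_comm 1 0, totalD_casGrad_comm 2 0, totalD_casGrad_comm 2 1,
    totalD_rhoGrad_comm 1 0, totalD_rhoGrad_comm 2 0, totalD_rhoGrad_comm 2 1]
  push_cast
  simp only [C_add, C_1]
  ring

/-- Exactness of the leafwise complex on linear differential operators: a solution `s` of
`s ⬝ ∇a = 0`, `div (s / ϱ ^ m) = 0` is of the form `s / ϱ ^ m = ∇a × ∇ (h / ϱ ^ (m + j))`. -/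
theorem exists_eq_casCross (n : ℕ) : ∀ (m : ℕ) (s : Fin 3 → SymbolRing),
    (∀ k, n ≤ k → ∀ i, homogeneousComponent k (s i) = 0) →
    ∑ i, C (casGrad i) * s i = 0 →
    C rhoVar * ∑ i, nabla i (s i) = C (m : DiffPoly) * ∑ i, C (rhoGrad i) * s i →
    ∃ (j : ℕ) (h : SymbolRing), ∀ i,
      C rhoVar ^ (j + 1) * s i = casCross (twistedGrad (m + j) h) i := by
  induction n with
  | zero =>
    intro m s hs _ _
    have h0 : ∀ i, s i = 0 := fun i => eq_zero_of_homogeneousComponent fun k => hs k k.zero_le i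
    refine ⟨0, 0, fun i => ?_⟩
    fin_cases i <;> simp [h0, casCross, twistedGrad, nabla]
  | succ n ih =>
    intro m s hs hcas hdiv
    have hr : (C rhoVar : SymbolRing) ≠ 0 := by
      rw [Ne, C_eq_zero]; exact X_ne_zero _
    -- The order is at most `n`. Degree `n` of the Casimir equation and degree `n + 1` of the
    -- divergence equation are the two orthogonality conditions on the leading symbol.
    obtain ⟨h, hh0, hh1, hh2⟩ := exists_eq_mul_cross (fun i => homogeneousComponent n (s i))
      (by
        have := congrArg (homogeneousComponent n) hcas
        simpa [Fin.sum_univ_three, homogeneousComponent_C_mul] using this)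
      (by
        have := congrArg (homogeneousComponent (n + 1)) hdiv
        simp only [homogeneousComponent_C_mul, map_sum, hs (n + 1) le_rfl,
          homogeneousComponent_succ_nabla _ (hs (n + 1) le_rfl _), mul_zero,
          Finset.sum_const_zero] at this
        simpa [Fin.sum_univ_three, hr] using this)
    -- Only the part of `h` of degree `n - 1` contributes to the symbol; for `n = 0` there is none
    -- and the symbol vanishes.
    obtain ⟨h', hX, hv⟩ : ∃ h' : SymbolRing,
        (∀ i, X i * h' = homogeneousComponent n (X i * h)) ∧
        ∀ k, n ≤ k → homogeneousComponent k h' = 0 := by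
      cases n with
      | zero => exact ⟨0, fun i => by rw [homogeneousComponent_zero_X_mul, mul_zero], by simp⟩
      | succ n =>
        refine ⟨homogeneousComponent n h, fun i => (homogeneousComponent_succ_X_mul ..).symm, ?_⟩
        intro k hk
        exact homogeneousComponent_of_mem (homogeneousComponent_isHomogeneous n h) |>.trans
          (if_neg (by omega))
    have top : ∀ i, homogeneousComponent n (s i) = casCross (fun l => X l * h') i := by
      have idem : ∀ i, homogeneousComponent n (s i)
          = homogeneousComponent n (homogeneousComponent n (s i)) := fun i =>
        (homogeneousComponent_eq_self (homogeneousComponent_isHomogeneous n (s i))).symm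
      intro i
      rw [idem]
      fin_cases i
      · simp [hh0, casCross, hX, homogeneousComponent_C_mul]
      · simp [hh1, casCross, hX, homogeneousComponent_C_mul]
      · simp [hh2, casCross, hX, homogeneousComponent_C_mul]
    have htw : ∀ k, n ≤ k → ∀ i, homogeneousComponent k (twistedGrad m h' i)
        = C rhoVar * homogeneousComponent k (X i * h') := by
      intro k hk i
      rw [twistedGrad, map_sub, homogeneousComponent_C_mul, homogeneousComponent_C_mul, hv k hk,
        nabla, map_add, homogeneousComponent_coeffD, hv k hk, coeffD_zero, zero_add, mul_zero,
        sub_zero]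
    -- The exact operator has leading symbol `ϱ` times that of `s`, so the difference has order
    -- below `n`. The extra factor `ϱ` raises the denominator exponent to `m + 1`.
    obtain ⟨j, h'', hfin⟩ := ih (m + 1) (fun i => C rhoVar * s i - casCross (twistedGrad m h') i)
      (by
        intro k hk i
        have hcc : homogeneousComponent k (casCross (twistedGrad m h') i)
            = C rhoVar * homogeneousComponent k (casCross (fun l => X l * h') i) := by
          fin_cases i <;> simp [casCross, homogeneousComponent_C_mul, htw k hk] <;> ring
        rw [map_sub, homogeneousComponent_C_mul, hcc, ← mul_sub, ← top,
          homogeneousComponent_of_mem (homogeneousComponent_isHomogeneous n (s i))]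
        split_ifs with hkn
        · rw [hkn, sub_self, mul_zero]
        · rw [hs k (by omega), sub_zero, mul_zero])
      (by
        have h1 := casCross_orthogonal (twistedGrad m h')
        simp only [Fin.sum_univ_three] at h1 hcas ⊢
        linear_combination C rhoVar * hcas - h1)
      (by
        have h1 := divergence_casCross_twistedGrad m h'
        simp only [Fin.sum_univ_three, nabla_sub, nabla_C_mul, totalD_rhoVar] at h1 hdiv ⊢
        push_cast at h1 hdiv ⊢
        simp only [C_add, C_1] at h1 hdiv ⊢
        linear_combination C rhoVar * hdiv - h1)
    -- The potentials `h'' / ϱ ^ (m + 1 + j)` and `h' / ϱ ^ m`, added over the common denominator.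
    refine ⟨j + 1, h'' + C rhoVar ^ (j + 1) * h', fun i => ?_⟩
    have hf := hfin i
    have hpow : ∀ i, twistedGrad (m + (j + 1)) (C rhoVar ^ (j + 1) * h') i
        = C rhoVar ^ (j + 1) * twistedGrad m h' i := by
      intro i
      rw [twistedGrad, twistedGrad, ← C_pow, nabla_C_mul, Derivation.leibniz_pow, totalD_rhoVar]
      simp only [smul_eq_mul, nsmul_eq_mul, C_mul, C_pow, Nat.add_sub_cancel]
      push_cast
      simp only [C_add, C_1]
      ring
    have hadd : ∀ i, twistedGrad (m + (j + 1)) (h'' + C rhoVar ^ (j + 1) * h') i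
        = twistedGrad (m + 1 + j) h'' i + C rhoVar ^ (j + 1) * twistedGrad m h' i := by
      intro i
      rw [← hpow, show m + 1 + j = m + (j + 1) by omega]
      simp only [twistedGrad, nabla_add]
      ring
    have hcr : casCross (twistedGrad (m + (j + 1)) (h'' + C rhoVar ^ (j + 1) * h')) i
        = casCross (twistedGrad (m + 1 + j) h'') i
          + C rhoVar ^ (j + 1) * casCross (twistedGrad m h') i := by
      fin_cases i <;> simp only [casCross, hadd] <;> simp <;> ring
    rw [hcr, ← hf]
    ring

/-! ### From operators back to differential polynomials -/

/-- A differential polynomial of positive degree in `ϱ` whose gradient is proportional to that of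
the Casimir is zero. -/
theorem eq_zero_of_totalD_proportional {f : DiffPoly} {n : ℕ} (hn : n ≠ 0)
    (hf : IsHomogeneousInRho f n)
    (h : totalD 0 f * casGrad 1 = totalD 1 f * casGrad 0) : f = 0 := by
  have h1 : nabla 0 (linearize f) * C (casGrad 1) = nabla 1 (linearize f) * C (casGrad 0) := by
    have := congrArg linearize h
    simpa [Derivation.leibniz, linearize_casGrad, linearize_totalD, MvPolynomial.smul_eq_C_mul,
      mul_comm] using this
  -- The leading symbol is annihilated by the nonzero factor `a_y ξ_0 - a_x ξ_1`, so the order can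
  -- be lowered until nothing is left.
  have h2 : ∀ N, (∀ k, N ≤ k → homogeneousComponent k (linearize f) = 0) →
      ∀ k, homogeneousComponent k (linearize f) = 0 := by
    intro N
    induction N with
    | zero => exact fun h k => h k k.zero_le
    | succ N ih =>
      intro hN
      refine ih fun k hk => ?_
      obtain rfl | hk := hk.eq_or_lt
      · have h3 := congrArg (homogeneousComponent (N + 1)) h1
        rw [mul_comm, mul_comm _ (C (casGrad 0)), homogeneousComponent_C_mul,
          homogeneousComponent_C_mul, homogeneousComponent_succ_nabla _ (hN _ le_rfl),
          homogeneousComponent_succ_nabla _ (hN _ le_rfl)] at h3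
        have h4 : (C (casGrad 1) * X 0 - C (casGrad 0) * X 1 : SymbolRing)
            * homogeneousComponent N (linearize f) = 0 := by linear_combination h3
        refine (mul_eq_zero.1 h4).resolve_left fun h5 => ?_
        have h6 := congrArg (symbolEval (fun _ => 1) ![1, 0, 0]) h5
        simp [symbolEval, casGrad] at h6
      · exact hN k hk
  have h3 : linearize f = 0 := eq_zero_of_homogeneousComponent
    (h2 ((linearize f).totalDegree + 1) fun k hk => homogeneousComponent_eq_zero _ _ (by omega))
  have h4 := applyRho_linearize hf
  rw [h3, map_zero] at h4
  exact (mul_eq_zero.1 h4.symm).resolve_left (by exact_mod_cast hn)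

/-- If `∇a × (ϱ ∇f - k f ∇ϱ)` is divisible by a positive power of `ϱ`, then so is `f`. -/
theorem exists_potential (k : ℕ) : ∀ (z : Fin 3 → DiffPoly) (f : DiffPoly),
    (∀ i, rhoVar ^ k * z i = (![casGrad 1 * (rhoVar * totalD 2 f - k * rhoGrad 2 * f)
        - casGrad 2 * (rhoVar * totalD 1 f - k * rhoGrad 1 * f),
      casGrad 2 * (rhoVar * totalD 0 f - k * rhoGrad 0 * f)
        - casGrad 0 * (rhoVar * totalD 2 f - k * rhoGrad 2 * f),
      casGrad 0 * (rhoVar * totalD 1 f - k * rhoGrad 1 * f)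
        - casGrad 1 * (rhoVar * totalD 0 f - k * rhoGrad 0 * f)] : Fin 3 → DiffPoly) i) →
    ∃ f : DiffPoly, ∀ i, z i = (![rhoVar * (casGrad 1 * totalD 2 f - casGrad 2 * totalD 1 f),
      rhoVar * (casGrad 2 * totalD 0 f - casGrad 0 * totalD 2 f),
      rhoVar * (casGrad 0 * totalD 1 f - casGrad 1 * totalD 0 f)] : Fin 3 → DiffPoly) i := by
  induction k with
  | zero =>
    intro z f h
    refine ⟨f, fun i => ?_⟩
    have := h i
    fin_cases i <;> simp at this ⊢ <;> rw [this] <;> ring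
  | succ k ih =>
    intro z f h
    have hp : Prime rhoVar := X_prime
    have hdvd : rhoVar ∣ f := by
      classical
      have h2 := h 2
      simp only [Matrix.cons_val] at h2
      -- The third component read modulo `ϱ`. At `ϱ = a_y = 0` with all other variables `1` the
      -- factor before `f` equals `k + 1`, so it is not divisible by `ϱ`.
      have h3 : rhoVar ∣ ((k + 1 : ℕ) : DiffPoly) *
          (casGrad 0 * rhoGrad 1 - casGrad 1 * rhoGrad 0) * f := by
        refine ⟨casGrad 0 * totalD 1 f - casGrad 1 * totalD 0 f - rhoVar ^ k * z 2, ?_⟩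
        rw [pow_succ] at h2
        linear_combination h2
      refine (hp.dvd_or_dvd h3).resolve_left fun h4 => ?_
      have h5 := map_dvd (eval fun v => if v = (Letter.rho, 0) then (0 : ℝ)
        else if v = (Letter.cas, Pi.single 1 1) then 0 else 1) h4
      have h6 : (Pi.single 1 1 : Fin 3 → ℕ) ≠ 0 := fun e => by simpa using congrFun e 1
      have h7 : (Pi.single 0 1 : Fin 3 → ℕ) ≠ 0 := fun e => by simpa using congrFun e 0
      simp [rhoVar, rhoGrad, casGrad, single_ne_single, h6, h7] at h5
      norm_cast at h5
    obtain ⟨f', rfl⟩ := hdvd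
    -- For `f = ϱ f'` one has `ϱ ∇f - (k + 1) f ∇ϱ = ϱ (ϱ ∇f' - k f' ∇ϱ)`, so one factor `ϱ`
    -- cancels.
    refine ih z f' fun i => mul_left_cancel₀ hp.ne_zero ?_
    have hi := h i
    rw [← mul_assoc, ← pow_succ', hi]
    fin_cases i <;> simp [Derivation.leibniz, totalD_rhoVar] <;> ring

lemma applyRho_twistedGrad (m : ℕ) (h : SymbolRing) (i : Fin 3) :
    applyRho (twistedGrad m h i)
      = rhoVar * totalD i (applyRho h) - m * rhoGrad i * applyRho h := by
  rw [twistedGrad, map_sub, applyRho_C_mul, applyRho_C_mul, applyRho_nabla]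

/-- Triviality of the cohomology: a differential-polynomial vector field of degree `3` in `ϱ`
tangent to the levels of the Casimir, with `div (z / ϱ) = 0`, is `ϱ ∇a × ∇f`. -/
theorem exists_eq_rhoVar_mul_cross {z : Fin 3 → DiffPoly}
    (hz : ∀ i, IsHomogeneousInRho (z i) 3)
    (hcas : ∑ i, casGrad i * z i = 0)
    (hdiv : rhoVar * ∑ i, totalD i (z i) = ∑ i, rhoGrad i * z i) :
    ∃ f : DiffPoly, ∀ i, z i = (![rhoVar * (casGrad 1 * totalD 2 f - casGrad 2 * totalD 1 f),
      rhoVar * (casGrad 2 * totalD 0 f - casGrad 0 * totalD 2 f),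
      rhoVar * (casGrad 0 * totalD 1 f - casGrad 1 * totalD 0 f)] : Fin 3 → DiffPoly) i := by
  have lin_rhoVar : linearize rhoVar = 1 := by
    have h : Finsupp.equivFunOnFinite.symm (0 : Fin 3 → ℕ) = 0 := by ext; rfl
    rw [rhoVar, linearize_rho, h]
    rfl
  have nabla_one (i : Fin 3) : nabla i 1 = X i := by
    rw [nabla, ← C_1, C_apply, coeffD_monomial_one, zero_add, ← C_apply, C_1, mul_one]
  have lin_rhoGrad (i : Fin 3) : linearize (rhoGrad i) = X i := by
    rw [← totalD_rhoVar, linearize_totalD, lin_rhoVar, nabla_one]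
  have nabla_C (i : Fin 3) (p : DiffPoly) : nabla i (C p) = C (totalD i p) + X i * C p := by
    rw [← mul_one (C p), nabla_C_mul, nabla_one]; ring
  -- By the quotient rule `s / ϱ ^ 2` is the linearization of `z / ϱ`, whence the exponent `2`
  -- passed to `exists_eq_casCross`.
  set s : Fin 3 → SymbolRing := fun i => C rhoVar * linearize (z i) - C (z i) with hs
  -- Euler's identity gives `3 ϱ z - ϱ z`; in degree one the two terms would cancel and `z` would be
  -- lost.
  have happ (i : Fin 3) : applyRho (s i) = 2 * rhoVar * z i := by
    have h1 : applyRho (C (z i)) = z i * rhoVar := by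
      rw [C_apply, applyRho_monomial]; rfl
    simp only [hs]
    rw [map_sub, applyRho_C_mul, applyRho_linearize (hz i), h1]
    push_cast
    ring
  obtain ⟨n, hn⟩ := exists_homogeneousComponent_eq_zero s
  obtain ⟨j, h, hh⟩ := exists_eq_casCross n 2 s hn
    (by
      have h1 := congrArg linearize hcas
      have h2 := congrArg (C : DiffPoly → SymbolRing) hcas
      simp only [Fin.sum_univ_three, map_add, Derivation.leibniz, linearize_casGrad, smul_zero,
        add_zero, MvPolynomial.smul_eq_C_mul, C_mul, map_zero] at h1 h2 ⊢
      simp only [hs]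
      linear_combination C rhoVar * h1 - h2)
    (by
      have h1 := congrArg linearize hdiv
      have h2 := congrArg (C : DiffPoly → SymbolRing) hdiv
      simp only [Fin.sum_univ_three, map_add, Derivation.leibniz, lin_rhoVar, lin_rhoGrad,
        linearize_totalD, MvPolynomial.smul_eq_C_mul, C_mul, mul_one] at h1 h2 ⊢
      simp only [hs, nabla_sub, nabla_C_mul, nabla_C, totalD_rhoVar]
      have h3 : (C ((2 : ℕ) : DiffPoly) : SymbolRing) = 2 := map_natCast C 2
      rw [h3]
      linear_combination C rhoVar * h1 - 2 * h2)
  obtain ⟨f, hf⟩ := exists_potential (2 + j) (fun i => 2 * z i) (applyRho h) (by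
    intro i
    have h1 := congrArg applyRho (hh i)
    rw [← C_pow, applyRho_C_mul, happ] at h1
    have h2 : rhoVar ^ (2 + j) * (2 * z i) = rhoVar ^ (j + 1) * (2 * rhoVar * z i) := by ring
    rw [h2, h1]
    fin_cases i <;> simp [casCross, applyRho_C_mul, applyRho_twistedGrad])
  have half : (2 : DiffPoly) * C (1 / 2) = 1 := by
    rw [show (2 : DiffPoly) = C 2 from (map_ofNat C 2).symm, ← C_mul]
    norm_num
  refine ⟨C (1 / 2) * f, fun i => ?_⟩
  have h1 := hf i
  have h2 : z i = C (1 / 2) * (2 * z i) := by linear_combination -(z i) * half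
  rw [h2, h1]
  fin_cases i <;> simp [Derivation.leibniz] <;> ring

/-! ### Kernel-computable representation of differential polynomials -/

/-- The coordinate directions, as an enumeration that the kernel evaluates quickly. -/
inductive Axis : Type
  | x
  | y
  | z

/-- The index of a direction. -/
def Axis.toFin : Axis → Fin 3 := Axis.rec 0 1 2

/-- A jet variable together with the prime number that represents it. The letter is `ϱ` if
`letter = 0` and `a` otherwise; the multi-index is `(x, y, z)`. -/
structure JetCode where
  letter : ℕ
  x : ℕ
  y : ℕ
  z : ℕ
  key : ℕ
deriving DecidableEq

/-- The jet variable with the given letter code and multi-index. -/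
def jetVar (u a b c : ℕ) : Letter × (Fin 3 → ℕ) :=
  (if u = 0 then Letter.rho else Letter.cas, ![a, b, c])

/-- The first seventy primes. -/
def jetPrimes : List ℕ :=
  [2, 3, 5, 7, 11, 13, 17, 19, 23, 29, 31, 37, 41, 43, 47, 53, 59, 61, 67, 71, 73, 79, 83, 89, 97,
    101, 103, 107, 109, 113, 127, 131, 137, 139, 149, 151, 157, 163, 167, 173, 179, 181, 191, 193,
    197, 199, 211, 223, 227, 229, 233, 239, 241, 251, 257, 263, 269, 271, 277, 281, 283, 293, 307,
    311, 313, 317, 331, 337, 347, 349]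

/-- The jet variables of order at most four. -/
def jetTable : List JetCode :=
  List.zipWith (fun f p => f p)
    ((List.range 5).flatMap fun c => (List.range (5 - c)).flatMap fun b =>
      (List.range (5 - c - b)).flatMap fun a => [JetCode.mk 0 a b c, JetCode.mk 1 a b c])
    jetPrimes

/-- The key of a jet variable, or zero if the variable is not in the table. -/
def jetKey (u a b c : ℕ) : ℕ :=
  List.rec (motive := fun _ => ℕ) 0
    (fun e _ ih => Bool.rec ih e.key
      (and (Nat.beq e.letter u) (and (Nat.beq e.x a) (and (Nat.beq e.y b) (Nat.beq e.z c)))))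
    jetTable

/-- The value of a prime: the jet variable that it represents. -/
def primeValue (p : ℕ) : DiffPoly :=
  match jetTable.find? fun e => e.key = p with
  | some e => X (jetVar e.letter e.x e.y e.z)
  | none => 1

/-- The monomial represented by a natural number through its prime factorization. -/
def keyValue (n : ℕ) : DiffPoly :=
  if n = 0 then 0 else n.factorization.prod fun p e => primeValue p ^ e

/-- Unique factorization; the value `0` at the key `0` makes positivity hypotheses unnecessary. -/
lemma keyValue_mul (m n : ℕ) : keyValue (m * n) = keyValue m * keyValue n := by
  by_cases hm : m = 0
  · simp [hm, keyValue]
  by_cases hn : n = 0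
  · simp [hn, keyValue]
  simp only [keyValue, hm, hn, mul_eq_zero, or_self, if_false]
  rw [Nat.factorization_mul hm hn, Finsupp.prod_add_index' (by simp) (by simp [pow_add])]

lemma keyValue_one : keyValue 1 = 1 := by simp [keyValue]

lemma keyValue_prime {p : ℕ} (hp : p.Prime) : keyValue p = primeValue p := by
  rw [keyValue, if_neg hp.ne_zero, hp.factorization, Finsupp.prod_single_index (by simp), pow_one]

lemma prime_of_mem_jetPrimes : ∀ p ∈ jetPrimes, p.Prime := by
  simp only [jetPrimes, List.forall_mem_cons]
  norm_num

lemma jetTable_find (e : JetCode) (he : e ∈ jetTable) :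
    jetTable.find? (fun e' => e'.key = e.key) = some e := by
  have h : ∀ e ∈ jetTable, jetTable.find? (fun e' => e'.key = e.key) = some e := by
    decide +kernel
  exact h e he

lemma jetTable_key_mem (e : JetCode) (he : e ∈ jetTable) : e.key ∈ jetPrimes := by
  have h : ∀ e ∈ jetTable, e.key ∈ jetPrimes := by decide +kernel
  exact h e he

lemma keyValue_key {e : JetCode} (he : e ∈ jetTable) :
    keyValue e.key = X (jetVar e.letter e.x e.y e.z) := by
  rw [keyValue_prime (prime_of_mem_jetPrimes _ (jetTable_key_mem e he)), primeValue,
    jetTable_find e he]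

/-- The induction runs over sublists of the table. A zero key flags a missing variable, which
`KeyPoly.jet` then stores as `other`. -/
lemma jetKey_eq_zero_or (u a b c : ℕ) :
    jetKey u a b c = 0 ∨ keyValue (jetKey u a b c) = X (jetVar u a b c) := by
  have h : ∀ l : List JetCode, (∀ e ∈ l, e ∈ jetTable) →
      let k := List.rec (motive := fun _ => ℕ) 0
        (fun e _ ih => Bool.rec ih e.key
          (and (Nat.beq e.letter u) (and (Nat.beq e.x a) (and (Nat.beq e.y b) (Nat.beq e.z c))))) l
      k = 0 ∨ keyValue k = X (jetVar u a b c) := by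
    intro l
    induction l with
    | nil => exact fun _ => Or.inl rfl
    | cons e l ih =>
      intro hl
      have ih' := ih fun e he => hl e (List.mem_cons_of_mem _ he)
      simp only at ih' ⊢
      cases hb : (and (Nat.beq e.letter u)
        (and (Nat.beq e.x a) (and (Nat.beq e.y b) (Nat.beq e.z c)))) with
      | false => exact ih'
      | true =>
        simp only [Bool.and_eq_true, Nat.beq_eq] at hb
        obtain ⟨rfl, rfl, rfl, rfl⟩ := hb
        exact Or.inr (keyValue_key (hl e List.mem_cons_self))
  exact h jetTable fun _ => id

/-! ### Arithmetic of coded polynomials -/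

/-- Sorted lists of monomials with integer coefficients. The last constructor stands for an
arbitrary differential polynomial and is never met in actual computations. -/
inductive KeyPoly : Type
  | nil
  | cons (m : ℕ) (c : ℤ) (t : KeyPoly)
  | other (q : DiffPoly)

namespace KeyPoly

/-- The differential polynomial represented by a list of monomials. -/
def value : KeyPoly → DiffPoly
  | nil => 0
  | cons m c t => (c : DiffPoly) * keyValue m + t.value
  | other q => q

/-- Prepend a term unless its coefficient vanishes. -/
def consNonzero (m : ℕ) (c : ℤ) (p : KeyPoly) : KeyPoly :=
  Int.rec (motive := fun _ => KeyPoly)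
    (fun n => Nat.rec (motive := fun _ => KeyPoly) p
      (fun k _ => cons m (Int.ofNat (Nat.succ k)) p) n)
    (fun n => cons m (Int.negSucc n) p) c

lemma value_consNonzero (m : ℕ) (c : ℤ) (p : KeyPoly) :
    (consNonzero m c p).value = (c : DiffPoly) * keyValue m + p.value := by
  obtain (_ | n) | n := c
  · simp [consNonzero]
  · rfl
  · rfl

/-- Addition, by merging. -/
def add : KeyPoly → KeyPoly → KeyPoly := fun l =>
  KeyPoly.rec (motive := fun _ => KeyPoly → KeyPoly) (fun q => q)
    (fun a c l ih q => KeyPoly.rec (motive := fun _ => KeyPoly) (cons a c l)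
      (fun b d q' ih' => Bool.rec
        (Bool.rec (cons b d ih') (cons a c (ih (cons b d q'))) (Nat.ble a b))
        (consNonzero a (Int.add c d) (ih q')) (Nat.beq a b))
      (fun r => other ((cons a c l).value + r)) q)
    (fun r q => other (r + q.value)) l

/-- Sortedness plays no role in the value; it only ensures that like terms meet and cancel.
Multiplying all keys by a nonzero number preserves their order. -/
lemma value_add (p q : KeyPoly) : (add p q).value = p.value + q.value := by
  induction p generalizing q with
  | nil => simp [add, value]
  | other r => rfl
  | cons a c l ih =>
    induction q with
    | nil => simp [add, value]
    | other r => rfl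
    | cons b d q' ih' =>
      have step : add (cons a c l) (cons b d q') = Bool.rec
        (Bool.rec (cons b d (add (cons a c l) q')) (cons a c (add l (cons b d q')))
          (Nat.ble a b))
        (consNonzero a (Int.add c d) (add l q')) (Nat.beq a b) := rfl
      rw [step]
      cases h1 : Nat.beq a b with
      | true =>
        have hab : a = b := Nat.eq_of_beq_eq_true h1
        subst hab
        simp only [value_consNonzero, ih, value, Int.add_def, Int.cast_add]
        ring
      | false =>
        cases h2 : Nat.ble a b with
        | true => simp only [value, ih]; ring
        | false => simp only [value] at ih' ⊢; rw [ih']; ring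

/-- Multiplication by a monomial. -/
def scale (m : ℕ) (c : ℤ) (p : KeyPoly) : KeyPoly :=
  KeyPoly.rec (motive := fun _ => KeyPoly) nil
    (fun a d _ ih => cons (Nat.mul m a) (Int.mul c d) ih)
    (fun r => other ((c : DiffPoly) * keyValue m * r)) p

lemma value_scale (m : ℕ) (c : ℤ) (p : KeyPoly) :
    (scale m c p).value = (c : DiffPoly) * keyValue m * p.value := by
  induction p with
  | nil => simp [scale, value]
  | other r => rfl
  | cons a d t ih =>
    have step : scale m c (cons a d t) = cons (m * a) (c * d) (scale m c t) := rfl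
    rw [step, value, ih, keyValue_mul, value]
    push_cast
    ring

/-- Multiplication. -/
def mul (p q : KeyPoly) : KeyPoly :=
  KeyPoly.rec (motive := fun _ => KeyPoly) nil (fun a c _ ih => add (scale a c q) ih)
    (fun r => other (r * q.value)) p

lemma value_mul (p q : KeyPoly) : (mul p q).value = p.value * q.value := by
  induction p with
  | nil => simp [mul, value]
  | other r => rfl
  | cons a d t ih =>
    have step : mul (cons a d t) q = add (scale a d q) (mul t q) := rfl
    rw [step, value_add, value_scale, ih, value]
    ring

/-- The jet variable with letter code `u` and multi-index `(a, b, c)`. -/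
def jet (u a b c : ℕ) : KeyPoly :=
  Nat.rec (motive := fun _ => KeyPoly) (other (X (jetVar u a b c)))
    (fun k _ => cons (Nat.succ k) 1 nil) (jetKey u a b c)

lemma value_jet (u a b c : ℕ) : (jet u a b c).value = X (jetVar u a b c) := by
  have h := jetKey_eq_zero_or u a b c
  unfold jet
  cases hk : jetKey u a b c with
  | zero => rfl
  | succ k =>
    rw [hk] at h
    simpa [value] using h

/-- The key of the derivative of a jet variable. -/
def shiftKey (i : Axis) (e : JetCode) : ℕ :=
  Axis.rec (jetKey e.letter (Nat.succ e.x) e.y e.z) (jetKey e.letter e.x (Nat.succ e.y) e.z)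
    (jetKey e.letter e.x e.y (Nat.succ e.z)) i

/-- Pairs of keys of a jet variable and its derivative. -/
def shiftPairs (i : Axis) : List (ℕ × ℕ) :=
  List.rec (motive := fun _ => List (ℕ × ℕ)) []
    (fun e _ ih => Nat.rec (motive := fun _ => List (ℕ × ℕ)) ih
      (fun k _ => (e.key, Nat.succ k) :: ih) (shiftKey i e)) jetTable

lemma jetVar_succ_x (u a b c : ℕ) :
    jetVar u (a + 1) b c = ((jetVar u a b c).1, (jetVar u a b c).2 + Pi.single 0 1) := by
  refine Prod.ext rfl ?_
  ext i; fin_cases i <;> simp [jetVar]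

lemma jetVar_succ_y (u a b c : ℕ) :
    jetVar u a (b + 1) c = ((jetVar u a b c).1, (jetVar u a b c).2 + Pi.single 1 1) := by
  refine Prod.ext rfl ?_
  ext i; fin_cases i <;> simp [jetVar]

lemma jetVar_succ_z (u a b c : ℕ) :
    jetVar u a b (c + 1) = ((jetVar u a b c).1, (jetVar u a b c).2 + Pi.single 2 1) := by
  refine Prod.ext rfl ?_
  ext i; fin_cases i <;> simp [jetVar]

lemma totalD_of_mem_shiftPairs (i : Axis) :
    ∀ pq ∈ shiftPairs i, totalD i.toFin (keyValue pq.1) = keyValue pq.2 := by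
  have h : ∀ l : List JetCode, (∀ e ∈ l, e ∈ jetTable) →
      ∀ pq ∈ List.rec (motive := fun _ => List (ℕ × ℕ)) []
        (fun e _ ih => Nat.rec (motive := fun _ => List (ℕ × ℕ)) ih
          (fun k _ => (e.key, Nat.succ k) :: ih) (shiftKey i e)) l,
        totalD i.toFin (keyValue pq.1) = keyValue pq.2 := by
    intro l
    induction l with
    | nil => intro _ pq hpq; simp at hpq
    | cons e l ih =>
      intro hl
      have ih' := ih fun e he => hl e (List.mem_cons_of_mem _ he)
      have hv := keyValue_key (hl e List.mem_cons_self)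
      have hs : shiftKey i e = 0 ∨
          keyValue (shiftKey i e) = totalD i.toFin (keyValue e.key) := by
        rw [hv, totalD_X]
        cases i
        · have := jetKey_eq_zero_or e.letter (e.x + 1) e.y e.z
          rw [jetVar_succ_x] at this
          exact this
        · have := jetKey_eq_zero_or e.letter e.x (e.y + 1) e.z
          rw [jetVar_succ_y] at this
          exact this
        · have := jetKey_eq_zero_or e.letter e.x e.y (e.z + 1)
          rw [jetVar_succ_z] at this
          exact this
      simp only
      cases hk : shiftKey i e with
      | zero => exact ih'
      | succ k =>
        rw [hk] at hs
        intro pq hpq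
        rcases List.mem_cons.1 hpq with rfl | hpq
        · exact (hs.resolve_left (Nat.succ_ne_zero k)).symm
        · exact ih' pq hpq
  exact h jetTable fun _ => id

/-- The total derivative of `n`, times `acc`, by splitting off prime factors one by one. -/
def keyDAux (i : Axis) : List (ℕ × ℕ) → ℕ → ℕ → KeyPoly := fun l =>
  List.rec (motive := fun _ => ℕ → ℕ → KeyPoly)
    (fun n acc => Bool.rec (other (keyValue acc * totalD i.toFin (keyValue n))) nil (Nat.beq n 1))
    (fun pq _ ih => Nat.rec (motive := fun _ => ℕ → ℕ → KeyPoly) ih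
      (fun _ ih' n acc => Bool.rec (ih n acc)
        (add (cons (Nat.mul acc (Nat.mul (Nat.div n pq.1) pq.2)) 1 nil)
          (ih' (Nat.div n pq.1) (Nat.mul acc pq.1)))
        (Nat.beq (Nat.mod n pq.1) 0)) 8) l

lemma value_keyDAux (i : Axis) (l : List (ℕ × ℕ))
    (hl : ∀ pq ∈ l, totalD i.toFin (keyValue pq.1) = keyValue pq.2) (n acc : ℕ) :
    (keyDAux i l n acc).value = keyValue acc * totalD i.toFin (keyValue n) := by
  induction l generalizing n acc with
  | nil =>
    have step : keyDAux i [] n acc = Bool.rec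
      (other (keyValue acc * totalD i.toFin (keyValue n))) nil (Nat.beq n 1) := rfl
    rw [step]
    cases h : Nat.beq n 1 with
    | false => rfl
    | true =>
      rw [Nat.eq_of_beq_eq_true h, keyValue_one, Derivation.map_one_eq_zero, mul_zero]
      rfl
  | cons pq l ih =>
    have ih1 := ih fun pq h => hl pq (List.mem_cons_of_mem _ h)
    have hpq := hl pq List.mem_cons_self
    have h : ∀ (k n acc : ℕ), (Nat.rec (motive := fun _ => ℕ → ℕ → KeyPoly) (keyDAux i l)
      (fun _ ih' n acc => Bool.rec (keyDAux i l n acc)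
        (add (cons (Nat.mul acc (Nat.mul (Nat.div n pq.1) pq.2)) 1 nil)
          (ih' (Nat.div n pq.1) (Nat.mul acc pq.1)))
        (Nat.beq (Nat.mod n pq.1) 0)) k n acc).value
        = keyValue acc * totalD i.toFin (keyValue n) := by
      intro k
      induction k with
      | zero => exact ih1
      | succ k ihk =>
        intro n acc
        simp only
        cases hb : Nat.beq (Nat.mod n pq.1) 0 with
        | false => exact ih1 n acc
        | true =>
          have hd : n = pq.1 * (n / pq.1) :=
            (Nat.mul_div_cancel' (Nat.dvd_of_mod_eq_zero (Nat.eq_of_beq_eq_true hb))).symm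
          simp only [value_add, ihk, value]
          conv_rhs => rw [hd]
          have e1 (a b : ℕ) : a.mul b = a * b := rfl
          have e2 (a b : ℕ) : a.div b = a / b := rfl
          simp only [e1, e2, keyValue_mul, Derivation.leibniz, hpq, smul_eq_mul, Int.cast_one]
          ring
    -- The number `8` bounds how often one prime is split off; it covers the degree of every
    -- monomial that arises. Any unsplit remainder would end in `other`, so the value is right in
    -- all cases.
    exact h 8 n acc

/-- The total derivative. -/
def deriv (i : Axis) (p : KeyPoly) : KeyPoly :=
  KeyPoly.rec (motive := fun _ => KeyPoly) nil
    (fun m c _ ih => add (scale 1 c (keyDAux i (shiftPairs i) m 1)) ih)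
    (fun r => other (totalD i.toFin r)) p

lemma value_deriv (i : Axis) (p : KeyPoly) : (deriv i p).value = totalD i.toFin p.value := by
  induction p with
  | nil => simp [deriv, value]
  | other r => rfl
  | cons m c t ih =>
    have step : deriv i (cons m c t)
      = add (scale 1 c (keyDAux i (shiftPairs i) m 1)) (deriv i t) := rfl
    rw [step, value_add, value_scale, ih, value_keyDAux i _ (totalD_of_mem_shiftPairs i), value,
      map_add, Derivation.leibniz, Derivation.map_intCast, keyValue_one, smul_zero, smul_eq_mul]
    ring

/-- Sum over the three directions. -/
def sum3 (f : Axis → KeyPoly) : KeyPoly := add (f .x) (add (f .y) (f .z))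

lemma value_sum3 (f : Axis → KeyPoly) (g : Fin 3 → DiffPoly)
    (h : ∀ i, (f i).value = g i.toFin) : (sum3 f).value = ∑ i, g i := by
  simp only [sum3, value_add, h, Fin.sum_univ_three, Axis.toFin, add_assoc]

/-- Signed sum over the permutations of the three directions. -/
def altSum (f : Axis → Axis → Axis → KeyPoly) : KeyPoly :=
  add (add (f .x .y .z) (add (f .y .z .x) (f .z .x .y)))
    (scale 1 (-1) (add (f .y .x .z) (add (f .z .y .x) (f .x .z .y))))

/-- Whether a list of monomials is empty. -/
def isNil (p : KeyPoly) : Bool :=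
  KeyPoly.rec (motive := fun _ => Bool) true (fun _ _ _ _ => false) (fun _ => false) p

lemma value_eq_zero_of_isNil {p : KeyPoly} (h : p.isNil = true) : p.value = 0 := by
  cases p with
  | nil => rfl
  | cons m c t => exact absurd h (by simp [isNil])
  | other q => exact absurd h (by simp [isNil])

/-! ### The two sides of the coboundary identity in coded form -/

/-- The jet variable of the letter `u` for a list of directions. -/
def jetOf (u : ℕ) (l : List Axis) : KeyPoly :=
  List.rec (motive := fun _ => ℕ → ℕ → ℕ → KeyPoly) (fun a b c => jet u a b c)
    (fun i _ ih a b c => Axis.rec (ih (Nat.succ a) b c) (ih a (Nat.succ b) c)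
      (ih a b (Nat.succ c)) i) l 0 0 0

/-- The term `p` if the two directions agree, else zero. -/
def onAxis (d e : Axis) (p : KeyPoly) : KeyPoly :=
  Axis.rec (Axis.rec p nil nil e) (Axis.rec nil p nil e) (Axis.rec nil nil p e) d

/-- Product of a list. -/
def prod (c : ℤ) (l : List KeyPoly) : KeyPoly :=
  List.rec (motive := fun _ => KeyPoly) (cons 1 c nil) (fun p _ ih => mul p ih) l

/-- The components of the Nambu bi-vector. -/
def bivector (i j : Axis) : KeyPoly :=
  let p (k : Axis) (c : ℤ) : KeyPoly := prod c [jetOf 0 [], jetOf 1 [k]]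
  Axis.rec (Axis.rec nil (p .z 1) (p .y (-1)) j) (Axis.rec (p .z (-1)) nil (p .x 1) j)
    (Axis.rec (p .y 1) (p .x (-1)) nil j) i

/-- The graph with a vertex of in-degree three, for the Nambu bi-vector. -/
def tetraOne (i j : Axis) : KeyPoly :=
  sum3 fun k => sum3 fun m => sum3 fun p =>
    mul (deriv k (deriv m (deriv p (bivector i j)))) (sum3 fun l => sum3 fun q =>
      mul (deriv q (bivector k l))
        (sum3 fun n => mul (deriv l (bivector m n)) (deriv n (bivector p q))))

/-- The graph with two vertices of in-degree two, for the Nambu bi-vector. -/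
def tetraTwo (i j : Axis) : KeyPoly :=
  sum3 fun k => sum3 fun m => sum3 fun p =>
    mul (deriv m (deriv p (bivector i k))) (sum3 fun l => sum3 fun q =>
      mul (deriv k (deriv q (bivector j l)))
        (sum3 fun n => mul (deriv l (bivector m n)) (deriv n (bivector p q))))

/-- The component along `d` of the trivializing field before contraction. -/
def cobTerm (i0 i1 i2 j0 j1 j2 k0 k1 k2 d : Axis) : KeyPoly :=
  let r (l : List Axis) := jetOf 0 l
  let a (l : List Axis) := jetOf 1 l
  add (onAxis d k0 (prod 12 [r [], r [k1], r [i0, j0], a [k2], a [i1, j1], a [i2, j2]])) <|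
  add (onAxis d k1 (prod 48 [r [], r [j2], r [i0, j0], a [k2], a [i1, j1], a [i2, k0]])) <|
  add (onAxis d j0 (prod 8 [r [j1], r [i0, k0], r [i1, k1], a [i2], a [j2], a [k2]])) <|
  add (onAxis d j0 (prod (-40) [r [i2], r [j1], r [i0, k0], a [j2], a [k2], a [i1, k1]])) <|
  add (onAxis d j0 (prod 8 [r [i2], r [j1], r [k2], a [j2], a [i0, k0], a [i1, k1]])) <|
  add (onAxis d i1 (prod 24 [r [j1], r [k2], r [i0, k0], a [i2], a [j2], a [j0, k1]])) <|
  add (onAxis d k0 (prod (-12) [r [], r [], r [k1], a [i0, j0], a [i1, j1], a [i2, j2, k2]])) <|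
  add (onAxis d i1 (prod 24 [r [], r [j1], r [k0], a [k1], a [i0, j0], a [i2, j2, k2]])) <|
  add (onAxis d k0 (prod (-36) [r [], r [i1], r [j1], a [k1], a [i0, j0], a [i2, j2, k2]])) <|
  add (onAxis d i0 (prod 8 [r [i1], r [j0], r [k0], a [j1], a [k1], a [i2, j2, k2]]))
    (onAxis d i0 (prod (-8) [r [j0], r [k0], r [i2, j2, k2], a [i1], a [j1], a [k1]]))

/-- The components of the trivializing field. -/
def cobField (d : Axis) : KeyPoly :=
  altSum fun i0 i1 i2 => altSum fun j0 j1 j2 => altSum fun k0 k1 k2 =>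
    cobTerm i0 i1 i2 j0 j1 j2 k0 k1 k2 d

/-- The velocity of the density, times eight. -/
def rhoVelocity : KeyPoly :=
  add (mul (jetOf 0 []) (sum3 fun d => deriv d (cobField d)))
    (scale 1 (-1) (sum3 fun d => mul (jetOf 0 [d]) (cobField d)))

/-- The velocity of the Casimir, times minus eight. -/
def casVelocity : KeyPoly := sum3 fun d => mul (jetOf 1 [d]) (cobField d)

/-- The difference of the two sides of the coboundary identity in the component `(i, j)`, where
`(k, i, j)` is a cyclic permutation of the directions. -/
def defect (k i j : Axis) : KeyPoly :=
  add (add (scale 1 8 (tetraOne i j))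
      (scale 1 (-24) (add (tetraTwo i j) (scale 1 (-1) (tetraTwo j i)))))
    (add (scale 1 (-1) (mul rhoVelocity (jetOf 1 [k]))) (mul (jetOf 0 []) (deriv k casVelocity)))

/-- The coboundary identity, by computation. -/
lemma value_defect : (defect .z .x .y).value = 0 ∧ (defect .x .y .z).value = 0 ∧
    (defect .y .z .x).value = 0 := by
  -- The kernel expands the three components. Since `isNil` rejects `other`, success also certifies
  -- that no variable of order above four was needed.
  have h : and (isNil (defect .z .x .y)) (and (isNil (defect .x .y .z))
      (isNil (defect .y .z .x))) = true := by decide +kernel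
  simp only [Bool.and_eq_true] at h
  exact ⟨value_eq_zero_of_isNil h.1, value_eq_zero_of_isNil h.2.1, value_eq_zero_of_isNil h.2.2⟩

end KeyPoly

/-! ### The Levi-Civita symbol -/

/-- The Vandermonde product is alternating and equals `2` at `(0, 1, 2)`. -/
lemma leviCivita_apply (a b c : Fin 3) : leviCivita ![a, b, c]
    = ((b : ℝ) - (a : ℝ)) * ((c : ℝ) - (b : ℝ)) * ((c : ℝ) - (a : ℝ)) / 2 := by
  have h : ∀ a b c : Fin 3, 2 * ∑ σ : Equiv.Perm (Fin 3),
      (if (σ : Fin 3 → Fin 3) = ![a, b, c] then (Equiv.Perm.sign σ : ℤ) else 0)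
      = ((b : ℤ) - (a : ℤ)) * ((c : ℤ) - (b : ℤ)) * ((c : ℤ) - (a : ℤ)) := by
    decide +kernel
  have h1 := congrArg (fun n : ℤ => (n : ℝ)) (h a b c)
  push_cast at h1
  rw [eq_div_iff two_ne_zero, ← h1, mul_comm]
  rfl

lemma sum_leviCivita_smul {M : Type*} [AddCommGroup M] [Module ℝ M]
    (F : (Fin 3 → Fin 3) → M) :
    ∑ i, leviCivita i • F i = (F ![0, 1, 2] + (F ![1, 2, 0] + F ![2, 0, 1]))
      - (F ![1, 0, 2] + (F ![2, 1, 0] + F ![0, 2, 1])) := by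
  let e : Fin 3 × Fin 3 × Fin 3 ≃ (Fin 3 → Fin 3) :=
    { toFun := fun p => ![p.1, p.2.1, p.2.2]
      invFun := fun f => (f 0, f 1, f 2)
      left_inv := fun _ => rfl
      right_inv := fun f => by ext i; fin_cases i <;> rfl }
  have he : ∀ p, e p = ![p.1, p.2.1, p.2.2] := fun _ => rfl
  rw [← e.sum_comp]
  simp only [Fintype.sum_prod_type, Fin.sum_univ_three, he, leviCivita_apply]
  norm_num
  abel

/-! ### The Nambu bi-vector as a matrix of differential polynomials -/

/-- The components of the Nambu bi-vector. -/
def nambuPoly (i j : Fin 3) : DiffPoly :=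
  ∑ k, C (leviCivita ![k, i, j]) * (rhoVar * casGrad k)

lemma nambuPoly_values :
    nambuPoly 0 0 = 0 ∧ nambuPoly 0 1 = rhoVar * casGrad 2 ∧
    nambuPoly 0 2 = -(rhoVar * casGrad 1) ∧ nambuPoly 1 0 = -(rhoVar * casGrad 2) ∧
    nambuPoly 1 1 = 0 ∧ nambuPoly 1 2 = rhoVar * casGrad 0 ∧
    nambuPoly 2 0 = rhoVar * casGrad 1 ∧ nambuPoly 2 1 = -(rhoVar * casGrad 0) ∧
    nambuPoly 2 2 = 0 := by
  simp only [nambuPoly, Fin.sum_univ_three, leviCivita_apply]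
  norm_num

lemma nambuPoly_swap (i j : Fin 3) : nambuPoly i j = -nambuPoly j i := by
  simp only [nambuPoly, ← Finset.sum_neg_distrib, ← neg_mul, ← C_neg, leviCivita_apply]
  refine Finset.sum_congr rfl fun k _ => ?_
  congr 2
  ring

lemma evalJet_rhoVar (ϱ a : ScalarField) : evalJet rhoVar ϱ a = ϱ := evalJet_rho _ _ _

lemma pdMulti_single {f : ScalarField} (hf : ContDiff ℝ ∞ f) (i : Fin 3) :
    pdMulti (Pi.single i 1) f = pd i f := by
  have := pd_pdMulti hf i 0
  rwa [zero_add, pdMulti_zero, eq_comm] at this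

lemma evalJet_casGrad (ϱ : ScalarField) {a : ScalarField} (ha : ContDiff ℝ ∞ a) (i : Fin 3) :
    evalJet (casGrad i) ϱ a = pd i a := by
  rw [casGrad, evalJet_cas, pdMulti_single ha]

lemma evalJet_sum_leviCivita (p q : DiffPoly) {ϱ a : ScalarField} (hϱ : ContDiff ℝ ∞ ϱ)
    (ha : ContDiff ℝ ∞ a) (i j : Fin 3) :
    evalJet (∑ k, C (leviCivita ![k, i, j]) * (p * casGrad k + rhoVar * totalD k q)) ϱ a
      = nambu (evalJet p ϱ a) a i j + nambu ϱ (evalJet q ϱ a) i j := by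
  ext x
  rw [evalJet_sum]
  simp only [evalJet_mul, evalJet_add, evalJet_C, evalJet_rhoVar, evalJet_casGrad ϱ ha,
    Pi.mul_apply, Pi.add_apply, nambu, Finset.mul_sum, ← Finset.sum_add_distrib, pd_evalJet hϱ ha]
  exact Finset.sum_congr rfl fun k _ => by ring

lemma evalJet_nambuPoly (ϱ : ScalarField) {a : ScalarField} (ha : ContDiff ℝ ∞ a) (i j : Fin 3) :
    evalJet (nambuPoly i j) ϱ a = nambu ϱ a i j := by
  ext x
  rw [nambuPoly, evalJet_sum]
  simp only [evalJet_mul, evalJet_C, evalJet_rhoVar, evalJet_casGrad ϱ ha, Pi.mul_apply, nambu,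
    Finset.mul_sum]
  exact Finset.sum_congr rfl fun k _ => by ring

/-- In dimension three a bi-vector corresponds to a one-form `α`, here `ϱ da`, and the Jacobi
identity to `α ∧ dα = 0`. It is checked by components, using only the symmetry of second derivatives
of `a`. -/
theorem isPoisson_nambu {ϱ a : ScalarField} (hϱ : ContDiff ℝ ∞ ϱ) (ha : ContDiff ℝ ∞ a) :
    IsPoisson (nambu ϱ a) := by
  have key : ∀ i j k, ∑ l, (nambuPoly i l * totalD l (nambuPoly j k)
      + nambuPoly j l * totalD l (nambuPoly k i)
      + nambuPoly k l * totalD l (nambuPoly i j)) = 0 := by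
    obtain ⟨h00, h01, h02, h10, h11, h12, h20, h21, h22⟩ := nambuPoly_values
    intro i j k
    fin_cases i <;> fin_cases j <;> fin_cases k <;>
    · simp only [Fin.sum_univ_three, Fin.zero_eta, Fin.mk_one, Fin.reduceFinMk, Fin.isValue,
        h00, h01, h02, h10, h11, h12, h20, h21, h22, map_neg, map_zero, Derivation.leibniz,
        totalD_rhoVar, smul_eq_mul, totalD_casGrad_comm 1 0, totalD_casGrad_comm 2 0,
        totalD_casGrad_comm 2 1]
      ring
  constructor
  · intro i j x
    rw [← evalJet_nambuPoly ϱ ha, ← evalJet_nambuPoly ϱ ha, nambuPoly_swap]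
    simp [evalJet_apply]
  · intro i j k x
    have h := congrFun (congrArg (fun p => evalJet p ϱ a) (key i j k)) x
    simp only [evalJet_sum, evalJet_add, evalJet_mul, ← pd_evalJet hϱ ha,
      evalJet_nambuPoly ϱ ha, Pi.add_apply, Pi.mul_apply] at h
    rw [h]
    simp [evalJet_apply]

/-! ### The Schouten bracket with a vector field -/

/-- The Schouten bracket of the Nambu bi-vector and a vector field. -/
def schoutenPoly (Y : Fin 3 → DiffPoly) (i j : Fin 3) : DiffPoly :=
  ∑ l, (nambuPoly l j * totalD l (Y i) + nambuPoly i l * totalD l (Y j)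
    - Y l * totalD l (nambuPoly i j))

lemma evalJet_schoutenPoly {ϱ a : ScalarField} (hϱ : ContDiff ℝ ∞ ϱ) (ha : ContDiff ℝ ∞ a)
    (Y : Fin 3 → DiffPoly) (i j : Fin 3) :
    evalJet (schoutenPoly Y i j) ϱ a = schoutenVec (nambu ϱ a) (evalJetVec Y ϱ a) i j := by
  ext x
  rw [schoutenPoly, evalJet_sum]
  simp only [evalJet_add, evalJet_sub, evalJet_mul, ← pd_evalJet hϱ ha, evalJet_nambuPoly ϱ ha,
    Pi.add_apply, Pi.sub_apply, Pi.mul_apply, schoutenVec, evalJetVec]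

/-- The velocity of the density induced by a vector field. -/
def densityVelocity (Y : Fin 3 → DiffPoly) : DiffPoly :=
  rhoVar * ∑ l, totalD l (Y l) - ∑ l, rhoGrad l * Y l

/-- Minus the velocity of the Casimir induced by a vector field. -/
def casimirVelocity (Y : Fin 3 → DiffPoly) : DiffPoly := ∑ l, casGrad l * Y l

/-- The bracket is minus a Lie derivative and `P` is the contraction of `ϱ ∂_x ∧ ∂_y ∧ ∂_z` with
`da`. The Lie derivative of the trivector yields the divergence and the derivative of `ϱ`; that of
`da` yields `d(∇a·Y)`. -/
lemma schoutenPoly_eq (Y : Fin 3 → DiffPoly) (i j : Fin 3) :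
    schoutenPoly Y i j = ∑ k, C (leviCivita ![k, i, j]) *
      (densityVelocity Y * casGrad k + rhoVar * totalD k (-casimirVelocity Y)) := by
  obtain ⟨h00, h01, h02, h10, h11, h12, h20, h21, h22⟩ := nambuPoly_values
  simp only [schoutenPoly, densityVelocity, casimirVelocity, Fin.sum_univ_three, leviCivita_apply]
  fin_cases i <;> fin_cases j <;>
  · simp only [Fin.zero_eta, Fin.mk_one, Fin.reduceFinMk, Fin.isValue,
      h00, h01, h02, h10, h11, h12, h20, h21, h22, map_neg, map_add, map_zero,
      Derivation.leibniz, totalD_rhoVar, smul_eq_mul, totalD_casGrad_comm 1 0,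
      totalD_casGrad_comm 2 0, totalD_casGrad_comm 2 1]
    norm_num
    try ring

lemma schoutenPoly_sub (Y Z : Fin 3 → DiffPoly) (i j : Fin 3) :
    schoutenPoly (Y - Z) i j = schoutenPoly Y i j - schoutenPoly Z i j := by
  simp only [schoutenPoly, ← Finset.sum_sub_distrib, Pi.sub_apply, map_sub]
  exact Finset.sum_congr rfl fun l _ => by ring

/-- The Hamiltonian vector field of a differential polynomial. -/
def hamiltonianPoly (H : DiffPoly) (i : Fin 3) : DiffPoly := ∑ j, nambuPoly i j * totalD j H

lemma evalJet_hamiltonianPoly {ϱ a : ScalarField} (hϱ : ContDiff ℝ ∞ ϱ) (ha : ContDiff ℝ ∞ a)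
    (H : DiffPoly) :
    evalJetVec (hamiltonianPoly H) ϱ a = schoutenFun (nambu ϱ a) (evalJet H ϱ a) := by
  ext i x
  rw [evalJetVec, hamiltonianPoly, evalJet_sum]
  simp only [evalJet_mul, ← pd_evalJet hϱ ha, evalJet_nambuPoly ϱ ha, Pi.mul_apply, schoutenFun]

lemma hamiltonianPoly_values (H : DiffPoly) :
    hamiltonianPoly H 0 = rhoVar * (casGrad 2 * totalD 1 H - casGrad 1 * totalD 2 H) ∧
    hamiltonianPoly H 1 = rhoVar * (casGrad 0 * totalD 2 H - casGrad 2 * totalD 0 H) ∧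
    hamiltonianPoly H 2 = rhoVar * (casGrad 1 * totalD 0 H - casGrad 0 * totalD 1 H) := by
  obtain ⟨h00, h01, h02, h10, h11, h12, h20, h21, h22⟩ := nambuPoly_values
  simp only [hamiltonianPoly, Fin.sum_univ_three, h00, h01, h02, h10, h11, h12, h20, h21, h22]
  refine ⟨?_, ?_, ?_⟩ <;> ring

/-- Up to sign the field is `ϱ ∇a × ∇H`, and `∇a × ∇H` is orthogonal to `∇a` and divergence-free, so
both induced velocities vanish. -/
lemma schoutenPoly_hamiltonianPoly (H : DiffPoly) (i j : Fin 3) :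
    schoutenPoly (hamiltonianPoly H) i j = 0 := by
  obtain ⟨h0, h1, h2⟩ := hamiltonianPoly_values H
  have hd : densityVelocity (hamiltonianPoly H) = 0 := by
    simp only [densityVelocity, Fin.sum_univ_three, h0, h1, h2, Derivation.leibniz, map_sub,
      totalD_rhoVar, smul_eq_mul, totalD_casGrad_comm 1 0, totalD_casGrad_comm 2 0,
      totalD_casGrad_comm 2 1, totalD_comm 1 0, totalD_comm 2 0, totalD_comm 2 1]
    ring
  have hc : casimirVelocity (hamiltonianPoly H) = 0 := by
    simp only [casimirVelocity, Fin.sum_univ_three, h0, h1, h2]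
    ring
  simp [schoutenPoly_eq, hd, hc]

/-! ### The tetrahedral flow -/

/-- The right-hand side of the tetrahedral flow on differential polynomials. -/
def tetraPoly (P : Fin 3 → Fin 3 → DiffPoly) (i j : Fin 3) : DiffPoly :=
  (∑ k, ∑ l, ∑ m, ∑ n, ∑ p, ∑ q, totalD k (totalD m (totalD p (P i j))) * totalD q (P k l)
    * totalD l (P m n) * totalD n (P p q))
  - 3 * ((∑ k, ∑ l, ∑ m, ∑ n, ∑ p, ∑ q, totalD m (totalD p (P i k)) * totalD k (totalD q (P j l))
    * totalD l (P m n) * totalD n (P p q))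
    + ∑ k, ∑ l, ∑ m, ∑ n, ∑ p, ∑ q, totalD n (totalD p (P i k)) * totalD k (P l m)
    * totalD l (totalD q (P j n)) * totalD m (P p q))

lemma evalJet_tetraPoly {ϱ a : ScalarField} (hϱ : ContDiff ℝ ∞ ϱ) (ha : ContDiff ℝ ∞ a)
    (i j : Fin 3) : evalJet (tetraPoly nambuPoly i j) ϱ a = tetraFlow (nambu ϱ a) i j := by
  have h3 : evalJet 3 ϱ a = fun _ => 3 := by ext x; simp [evalJet_apply]
  ext x
  simp only [tetraPoly, evalJet_sub, evalJet_mul, evalJet_add, h3, Pi.sub_apply, Pi.mul_apply,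
    Pi.add_apply, evalJet_sum, ← pd_evalJet hϱ ha, evalJet_nambuPoly ϱ ha]
  rfl

/-- This order of summation lets each factor leave the sums over indices it does not contain, which
keeps the expansion small. -/
lemma sum_six_reorder {M : Type*} [AddCommMonoid M]
    (F : Fin 3 → Fin 3 → Fin 3 → Fin 3 → Fin 3 → Fin 3 → M) :
    ∑ k, ∑ l, ∑ m, ∑ n, ∑ p, ∑ q, F k l m n p q
      = ∑ k, ∑ m, ∑ p, ∑ l, ∑ q, ∑ n, F k l m n p q := by
  refine Finset.sum_congr rfl fun k _ => ?_
  rw [Finset.sum_comm]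
  refine Finset.sum_congr rfl fun m _ => ?_
  have h : ∀ l, ∑ n, ∑ p, ∑ q, F k l m n p q = ∑ p, ∑ q, ∑ n, F k l m n p q := fun l => by
    rw [Finset.sum_comm]
    exact Finset.sum_congr rfl fun p _ => Finset.sum_comm
  simp only [h]
  rw [Finset.sum_comm]

/-- The two graphs with two vertices of in-degree two are mirror images of each other. -/
lemma tetraPoly_eq {P : Fin 3 → Fin 3 → DiffPoly} (hP : ∀ i j, P i j = -P j i) (i j : Fin 3) :
    tetraPoly P i j
    = (∑ k, ∑ m, ∑ p, totalD k (totalD m (totalD p (P i j))) * ∑ l, ∑ q, totalD q (P k l)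
        * ∑ n, totalD l (P m n) * totalD n (P p q))
      - 3 * ((∑ k, ∑ m, ∑ p, totalD m (totalD p (P i k)) * ∑ l, ∑ q, totalD k (totalD q (P j l))
          * ∑ n, totalD l (P m n) * totalD n (P p q))
        - ∑ k, ∑ m, ∑ p, totalD m (totalD p (P j k)) * ∑ l, ∑ q, totalD k (totalD q (P i l))
          * ∑ n, totalD l (P m n) * totalD n (P p q)) := by
  simp only [Finset.mul_sum]
  rw [← sum_six_reorder fun k l m n p q => totalD k (totalD m (totalD p (P i j)))
      * (totalD q (P k l) * (totalD l (P m n) * totalD n (P p q))),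
    ← sum_six_reorder fun k l m n p q => totalD m (totalD p (P i k))
      * (totalD k (totalD q (P j l)) * (totalD l (P m n) * totalD n (P p q))),
    ← sum_six_reorder fun k l m n p q => totalD m (totalD p (P j k))
      * (totalD k (totalD q (P i l)) * (totalD l (P m n) * totalD n (P p q)))]
  have h3 : (∑ k, ∑ l, ∑ m, ∑ n, ∑ p, ∑ q, totalD n (totalD p (P i k)) * totalD k (P l m)
      * totalD l (totalD q (P j n)) * totalD m (P p q))
      = -∑ k, ∑ l, ∑ m, ∑ n, ∑ p, ∑ q, totalD m (totalD p (P j k))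
      * (totalD k (totalD q (P i l)) * (totalD l (P m n) * totalD n (P p q))) := by
    -- The relabelling carries the third graph to the second with `i` and `j` exchanged, up to
    -- reversing the last copy `P p q`; this reversal gives the sign.
    let e : Fin 3 × Fin 3 × Fin 3 × Fin 3 × Fin 3 × Fin 3 ≃
        Fin 3 × Fin 3 × Fin 3 × Fin 3 × Fin 3 × Fin 3 :=
      { toFun := fun ⟨k, l, m, n, p, q⟩ => (n, k, l, m, q, p)
        invFun := fun ⟨n, k, l, m, q, p⟩ => (k, l, m, n, p, q)
        left_inv := fun _ => rfl
        right_inv := fun _ => rfl }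
    simp only [← Fintype.sum_prod_type', ← Finset.sum_neg_distrib]
    refine Fintype.sum_equiv e _ _ fun ⟨k, l, m, n, p, q⟩ => ?_
    simp only [e, Equiv.coe_fn_mk]
    rw [hP q p, totalD_comm l q]
    simp only [map_neg]
    ring
  rw [tetraPoly, h3]
  simp only [mul_assoc]
  ring

/-! ### Agreement of the coded expressions with the differential polynomials -/

namespace KeyPoly

lemma value_jetOf (u : ℕ) (l : List Axis) : (jetOf u l).value
    = X (if u = 0 then Letter.rho else Letter.cas, fun c => (l.map Axis.toFin).count c) := by
  have h : ∀ (l : List Axis) (a b c : ℕ),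
      (List.rec (motive := fun _ => ℕ → ℕ → ℕ → KeyPoly) (fun a b c => jet u a b c)
        (fun i _ ih a b c => Axis.rec (ih (Nat.succ a) b c) (ih a (Nat.succ b) c)
          (ih a b (Nat.succ c)) i) l a b c).value
      = X (if u = 0 then Letter.rho else Letter.cas,
          ![a, b, c] + fun c => (l.map Axis.toFin).count c) := by
    intro l
    induction l with
    | nil =>
      intro a b c
      rw [value_jet, jetVar]
      congr 2
    | cons i l ih =>
      intro a b c
      cases i
      all_goals
        simp only
        rw [ih]
        congr 2
        ext i
        fin_cases i <;> (simp [Axis.toFin, List.count_cons]; all_goals omega)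
  have h0 := h l 0 0 0
  have hz : (![0, 0, 0] : Fin 3 → ℕ) = 0 := by ext i; fin_cases i <;> rfl
  rwa [hz, zero_add] at h0

lemma value_jetOf_zero (l : List Axis) : (jetOf 0 l).value = jr (l.map Axis.toFin) :=
  value_jetOf 0 l

lemma value_jetOf_one (l : List Axis) : (jetOf 1 l).value = ja (l.map Axis.toFin) :=
  value_jetOf 1 l

lemma value_prod (c : ℤ) (l : List KeyPoly) :
    (prod c l).value = (c : DiffPoly) * (l.map value).prod := by
  induction l with
  | nil => simp [prod, value, keyValue_one]
  | cons p l ih =>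
    have step : prod c (p :: l) = mul p (prod c l) := rfl
    rw [step, value_mul, ih, List.map_cons, List.prod_cons]
    ring

lemma value_onAxis (d e : Axis) (p : KeyPoly) :
    (onAxis d e p).value = along e.toFin p.value d.toFin := by
  cases d <;> cases e <;> simp [onAxis, along, Axis.toFin, value]

lemma value_altSum (f : Axis → Axis → Axis → KeyPoly) (F : (Fin 3 → Fin 3) → DiffPoly)
    (h : ∀ i j k, (f i j k).value = F ![i.toFin, j.toFin, k.toFin]) :
    (altSum f).value = ∑ i, leviCivita i • F i := by
  rw [sum_leviCivita_smul]
  simp only [altSum, value_add, value_scale, h, keyValue_one, Axis.toFin]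
  push_cast
  ring

end KeyPoly

lemma jr_nil : jr [] = rhoVar := rfl

lemma count_singleton_eq_single (i : Fin 3) :
    (fun c => [i].count c) = (Pi.single i 1 : Fin 3 → ℕ) := by
  ext j
  fin_cases i <;> fin_cases j <;> rfl

lemma jr_singleton (i : Fin 3) : jr [i] = rhoGrad i := by
  rw [jr, count_singleton_eq_single, rhoGrad]

lemma ja_singleton (i : Fin 3) : ja [i] = casGrad i := by
  rw [ja, count_singleton_eq_single, casGrad]

namespace KeyPoly

lemma value_bivector (i j : Axis) : (bivector i j).value = nambuPoly i.toFin j.toFin := by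
  obtain ⟨h00, h01, h02, h10, h11, h12, h20, h21, h22⟩ := nambuPoly_values
  cases i <;> cases j <;>
  simp [bivector, value_prod, value_jetOf_zero, value_jetOf_one, jr_nil, ja_singleton, Axis.toFin,
    h00, h01, h02, h10, h11, h12, h20, h21, h22, value]

lemma value_tetraOne (i j : Axis) : (tetraOne i j).value
    = ∑ k, ∑ m, ∑ p, totalD k (totalD m (totalD p (nambuPoly i.toFin j.toFin)))
      * ∑ l, ∑ q, totalD q (nambuPoly k l)
        * ∑ n, totalD l (nambuPoly m n) * totalD n (nambuPoly p q) := by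
  refine value_sum3 _ _ fun k => value_sum3 _ _ fun m => value_sum3 _ _ fun p => ?_
  refine (value_mul _ _).trans (congrArg₂ _ (by simp only [value_deriv, value_bivector]) ?_)
  refine value_sum3 _ _ fun l => value_sum3 _ _ fun q => ?_
  refine (value_mul _ _).trans (congrArg₂ _ (by simp only [value_deriv, value_bivector]) ?_)
  exact value_sum3 _ _ fun n => by simp only [value_mul, value_deriv, value_bivector]

lemma value_tetraTwo (i j : Axis) : (tetraTwo i j).value
    = ∑ k, ∑ m, ∑ p, totalD m (totalD p (nambuPoly i.toFin k))
      * ∑ l, ∑ q, totalD k (totalD q (nambuPoly j.toFin l))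
        * ∑ n, totalD l (nambuPoly m n) * totalD n (nambuPoly p q) := by
  refine value_sum3 _ _ fun k => value_sum3 _ _ fun m => value_sum3 _ _ fun p => ?_
  refine (value_mul _ _).trans (congrArg₂ _ (by simp only [value_deriv, value_bivector]) ?_)
  refine value_sum3 _ _ fun l => value_sum3 _ _ fun q => ?_
  refine (value_mul _ _).trans (congrArg₂ _ (by simp only [value_deriv, value_bivector]) ?_)
  exact value_sum3 _ _ fun n => by simp only [value_mul, value_deriv, value_bivector]

lemma value_cobTerm (i0 i1 i2 j0 j1 j2 k0 k1 k2 d : Axis) :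
    (cobTerm i0 i1 i2 j0 j1 j2 k0 k1 k2 d).value
      = trivTerm ![i0.toFin, i1.toFin, i2.toFin] ![j0.toFin, j1.toFin, j2.toFin]
        ![k0.toFin, k1.toFin, k2.toFin] d.toFin := by
  have along_neg (m d : Fin 3) (p : DiffPoly) : along m (-p) d = -along m p d := by
    simp [along, Pi.single_neg]
  simp only [cobTerm, value_add, value_onAxis, value_prod, value_jetOf_zero, value_jetOf_one,
    List.map_cons, List.map_nil, List.prod_cons, List.prod_nil, trivTerm, Pi.add_apply,
    Pi.sub_apply, Matrix.cons_val_zero, Matrix.cons_val_one, Matrix.cons_val, sub_eq_add_neg,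
    Pi.neg_apply, ← along_neg, mul_one, add_assoc]
  push_cast
  simp only [mul_assoc, pow_two, neg_mul]

lemma value_cobField (d : Axis) : (cobField d).value = trivField d.toFin := by
  have h : trivField = ∑ i : Fin 3 → Fin 3, leviCivita i • ∑ j : Fin 3 → Fin 3, leviCivita j •
      ∑ k : Fin 3 → Fin 3, leviCivita k • trivTerm i j k := by
    simp only [trivField, Finset.smul_sum, smul_smul, mul_assoc]
  rw [h]
  simp only [Finset.sum_apply, Pi.smul_apply]
  refine value_altSum _ _ fun i0 i1 i2 => ?_
  refine value_altSum _ _ fun j0 j1 j2 => ?_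
  refine value_altSum _ _ fun k0 k1 k2 => ?_
  exact value_cobTerm ..

lemma value_rhoVelocity : rhoVelocity.value = densityVelocity trivField := by
  rw [rhoVelocity, value_add, value_mul, value_scale,
    value_sum3 _ (fun l => totalD l (trivField l)) fun i => by rw [value_deriv, value_cobField],
    value_sum3 _ (fun l => rhoGrad l * trivField l) fun i => by
      rw [value_mul, value_cobField, value_jetOf_zero, List.map_cons, List.map_nil, jr_singleton],
    value_jetOf_zero, List.map_nil, jr_nil, densityVelocity, keyValue_one]
  push_cast
  ring

lemma value_casVelocity : casVelocity.value = casimirVelocity trivField := by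
  rw [casVelocity,
    value_sum3 _ (fun l => casGrad l * trivField l) fun i => by
      rw [value_mul, value_cobField, value_jetOf_one, List.map_cons, List.map_nil, ja_singleton],
    casimirVelocity]

lemma value_defect_eq (k i j : Axis) : (defect k i j).value
    = 8 * tetraPoly nambuPoly i.toFin j.toFin
      - (densityVelocity trivField * casGrad k.toFin
        + rhoVar * totalD k.toFin (-casimirVelocity trivField)) := by
  rw [tetraPoly_eq nambuPoly_swap]
  simp only [defect, value_add, value_scale, value_mul, value_deriv, value_tetraOne,
    value_tetraTwo, value_rhoVelocity, value_casVelocity, value_jetOf_zero, value_jetOf_one,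
    List.map_cons, List.map_nil, jr_nil, ja_singleton, keyValue_one, map_neg]
  push_cast
  ring

end KeyPoly

lemma tetraPoly_swap (i j : Fin 3) : tetraPoly nambuPoly i j = -tetraPoly nambuPoly j i := by
  rw [tetraPoly_eq nambuPoly_swap, tetraPoly_eq nambuPoly_swap, nambuPoly_swap i j]
  simp only [map_neg, neg_mul, Finset.sum_neg_distrib]
  ring

lemma schoutenPoly_swap (Y : Fin 3 → DiffPoly) (i j : Fin 3) :
    schoutenPoly Y i j = -schoutenPoly Y j i := by
  simp only [schoutenPoly_eq, ← Finset.sum_neg_distrib, ← neg_mul, ← C_neg, leviCivita_apply]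
  refine Finset.sum_congr rfl fun k _ => ?_
  congr 2
  ring

/-! ### The coboundary identity and uniqueness modulo Hamiltonian fields -/

/-- The tetrahedral flow of the Nambu bi-vector is a Poisson coboundary. -/
theorem eight_mul_tetraPoly (i j : Fin 3) :
    8 * tetraPoly nambuPoly i j = schoutenPoly trivField i j := by
  obtain ⟨h2, h0, h1⟩ := KeyPoly.value_defect
  rw [KeyPoly.value_defect_eq, sub_eq_zero] at h0 h1 h2
  have cyc : ∀ k i j : Fin 3, (k, i, j) ∈ ([(2, 0, 1), (0, 1, 2), (1, 2, 0)] : List _) →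
      schoutenPoly trivField i j = densityVelocity trivField * casGrad k
        + rhoVar * totalD k (-casimirVelocity trivField) := by
    intro k i j h
    simp only [List.mem_cons, Prod.mk.injEq, List.not_mem_nil, or_false] at h
    rw [schoutenPoly_eq, Fin.sum_univ_three]
    simp only [leviCivita_apply]
    rcases h with ⟨rfl, rfl, rfl⟩ | ⟨rfl, rfl, rfl⟩ | ⟨rfl, rfl, rfl⟩ <;> norm_num
  have e01 : 8 * tetraPoly nambuPoly 0 1 = schoutenPoly trivField 0 1 :=
    h2.trans (cyc 2 0 1 (by simp)).symm
  have e12 : 8 * tetraPoly nambuPoly 1 2 = schoutenPoly trivField 1 2 :=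
    h0.trans (cyc 0 1 2 (by simp)).symm
  have e20 : 8 * tetraPoly nambuPoly 2 0 = schoutenPoly trivField 2 0 :=
    h1.trans (cyc 1 2 0 (by simp)).symm
  have swap : ∀ i j, 8 * tetraPoly nambuPoly i j = schoutenPoly trivField i j →
      8 * tetraPoly nambuPoly j i = schoutenPoly trivField j i := fun i j h => by
    rw [tetraPoly_swap, schoutenPoly_swap, ← h]; ring
  have diag : ∀ i, 8 * tetraPoly nambuPoly i i = schoutenPoly trivField i i := fun i => by
    rw [self_eq_neg.1 (tetraPoly_swap i i), self_eq_neg.1 (schoutenPoly_swap trivField i i),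
      mul_zero]
  fin_cases i <;> fin_cases j
  exacts [diag 0, e01, swap 2 0 e20, swap 0 1 e01, diag 1, e12, e20, swap 1 2 e12, diag 2]

lemma isHomogeneousInRho_trivField (d : Fin 3) : IsHomogeneousInRho (trivField d) 3 := by
  have hr (I : List (Fin 3)) : IsWeightedHomogeneous rhoWeight (jr I) 1 :=
    isWeightedHomogeneous_X ℝ rhoWeight _
  have ha (I : List (Fin 3)) : IsWeightedHomogeneous rhoWeight (ja I) 0 :=
    isWeightedHomogeneous_X ℝ rhoWeight _
  have hc (n : ℕ) [n.AtLeastTwo] :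
      IsWeightedHomogeneous rhoWeight (OfNat.ofNat n : DiffPoly) 0 := by
    rw [← map_ofNat (C (σ := Letter × (Fin 3 → ℕ)) (R := ℝ)) n]
    exact isWeightedHomogeneous_C rhoWeight _
  have hal (m : Fin 3) (p : DiffPoly) (hp : IsWeightedHomogeneous rhoWeight p 3) (d : Fin 3) :
      IsWeightedHomogeneous rhoWeight (along m p d) 3 := by
    by_cases h : d = m
    · subst h; simpa [along] using hp
    · simpa [along, h] using isWeightedHomogeneous_zero ℝ rhoWeight 3
  have hsub {p q : DiffPoly} (hp : IsWeightedHomogeneous rhoWeight p 3)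
      (hq : IsWeightedHomogeneous rhoWeight q 3) : IsWeightedHomogeneous rhoWeight (p - q) 3 :=
    (weightedHomogeneousSubmodule ℝ rhoWeight 3).sub_mem hp hq
  have hmon (n : ℕ) [n.AtLeastTwo] (I J K L M N : List (Fin 3)) :
      IsWeightedHomogeneous rhoWeight
        ((OfNat.ofNat n : DiffPoly) * jr I * jr J * jr K * ja L * ja M * ja N) 3 :=
    ((((((hc n).mul (hr I)).mul (hr J)).mul (hr K)).mul (ha L)).mul (ha M)).mul (ha N)
  have hterm (i j k : Fin 3 → Fin 3) : IsWeightedHomogeneous rhoWeight (trivTerm i j k d) 3 := by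
    have hsq : IsWeightedHomogeneous rhoWeight ((12 : DiffPoly) * jr [] ^ 2 * jr [k 1] *
        ja [i 0, j 0] * ja [i 1, j 1] * ja [i 2, j 2, k 2]) 3 := by
      rw [pow_two, ← mul_assoc]
      exact hmon 12 _ _ _ _ _ _
    simp only [trivTerm, Pi.add_apply, Pi.sub_apply]
    exact hsub ((hsub ((hsub ((((hsub (((hal _ _ (hmon 12 ..) d).add
      (hal _ _ (hmon 48 ..) d)).add (hal _ _ (hmon 8 ..) d)) (hal _ _ (hmon 40 ..) d)).add
      (hal _ _ (hmon 8 ..) d)).add (hal _ _ (hmon 24 ..) d))) (hal _ _ hsq d)).add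
      (hal _ _ (hmon 24 ..) d)) (hal _ _ (hmon 36 ..) d)).add (hal _ _ (hmon 8 ..) d))
      (hal _ _ (hmon 8 ..) d)
  rw [isHomogeneousInRho_iff, trivField]
  simp only [Finset.sum_apply, Pi.smul_apply]
  refine IsWeightedHomogeneous.sum _ _ _ fun i _ => IsWeightedHomogeneous.sum _ _ _ fun j _ =>
    IsWeightedHomogeneous.sum _ _ _ fun k _ => ?_
  exact (weightedHomogeneousSubmodule ℝ rhoWeight 3).smul_mem _ (hterm i j k)

/-- A vector field of degree `3` in `ϱ` which preserves the Nambu bi-vector is Hamiltonian. -/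
theorem exists_eq_hamiltonianPoly {z : Fin 3 → DiffPoly} (hz : ∀ i, IsHomogeneousInRho (z i) 3)
    (h : ∀ i j, schoutenPoly z i j = 0) : ∃ H : DiffPoly, z = hamiltonianPoly H := by
  have hr : rhoVar ≠ 0 := X_ne_zero _
  have hg (k : Fin 3) : casGrad k ≠ 0 := X_ne_zero _
  have h01 := h 0 1
  have h12 := h 1 2
  simp only [schoutenPoly_eq, Fin.sum_univ_three, leviCivita_apply] at h01 h12
  have h20 := h 2 0
  simp only [schoutenPoly_eq, Fin.sum_univ_three, leviCivita_apply] at h20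
  norm_num at h01 h12 h20
  have hcas : casimirVelocity z = 0 := by
    refine eq_zero_of_totalD_proportional (n := 3) (by norm_num) ?_ (mul_left_cancel₀ hr ?_)
    · rw [isHomogeneousInRho_iff, casimirVelocity]
      refine IsWeightedHomogeneous.sum _ _ _ fun l _ => ?_
      have := (isWeightedHomogeneous_X ℝ rhoWeight (Letter.cas, Pi.single l 1)).mul
        (isHomogeneousInRho_iff.1 (hz l))
      exact this
    -- Eliminating the density velocity between two components leaves the proportionality of
    -- gradients, up to a factor `ϱ`.
    · linear_combination casGrad 0 * h20 - casGrad 1 * h12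
  rw [hcas, map_zero, mul_zero, neg_zero, add_zero] at h01
  have hden : densityVelocity z = 0 := (mul_eq_zero.1 h01).resolve_right (hg 2)
  obtain ⟨f, hf⟩ := exists_eq_rhoVar_mul_cross hz hcas (sub_eq_zero.1 hden)
  -- The sign is needed because the Hamiltonian field of `H` is `-ϱ ∇a × ∇H`.
  obtain ⟨h0, h1, h2⟩ := hamiltonianPoly_values (-f)
  refine ⟨-f, funext fun i => ?_⟩
  rw [hf i]
  fin_cases i <;>
  simp only [Fin.zero_eta, Fin.mk_one, Fin.reduceFinMk, Matrix.cons_val_zero, Matrix.cons_val_one,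
    Matrix.cons_val, h0, h1, h2, map_neg] <;> ring

end

theorem theorem1 :
    -- Nambu-determinant bi-vectors are Poisson
    (∀ ϱ a : ScalarField, ContDiff ℝ ∞ ϱ → ContDiff ℝ ∞ a → IsPoisson (nambu ϱ a)) ∧
    -- the flow restricts: it is induced by differential-polynomial velocities of `ϱ` and `a`
    (∃ r c : DiffPoly, ∀ ϱ a : ScalarField, ContDiff ℝ ∞ ϱ → ContDiff ℝ ∞ a →
      tetraFlow (nambu ϱ a) = nambu (evalJet r ϱ a) a + nambu ϱ (evalJet c ϱ a)) ∧
    -- the restricted flow is a Poisson coboundary, with the explicit vector field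
    (∀ ϱ a : ScalarField, ContDiff ℝ ∞ ϱ → ContDiff ℝ ∞ a →
      (8 : ℝ) • tetraFlow (nambu ϱ a)
        = schoutenVec (nambu ϱ a) (evalJetVec trivField ϱ a)) ∧
    -- the trivializing fields cubic in `ϱ` form one class modulo Hamiltonian fields
    (∀ Y : Fin 3 → DiffPoly, (∀ l, IsHomogeneousInRho (Y l) 3) →
      ((∀ ϱ a : ScalarField, ContDiff ℝ ∞ ϱ → ContDiff ℝ ∞ a →
          (8 : ℝ) • tetraFlow (nambu ϱ a)
            = schoutenVec (nambu ϱ a) (evalJetVec Y ϱ a)) ↔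
        ∃ H : DiffPoly, ∀ ϱ a : ScalarField, ContDiff ℝ ∞ ϱ → ContDiff ℝ ∞ a →
          evalJetVec Y ϱ a
            = evalJetVec trivField ϱ a + schoutenFun (nambu ϱ a) (evalJet H ϱ a))) := by
  have coboundary : ∀ ϱ a : ScalarField, ContDiff ℝ ∞ ϱ → ContDiff ℝ ∞ a →
      (8 : ℝ) • tetraFlow (nambu ϱ a)
        = schoutenVec (nambu ϱ a) (evalJetVec trivField ϱ a) := by
    intro ϱ a hϱ ha
    funext i j
    have h8 : evalJet 8 ϱ a = fun _ => 8 := by ext x; simp [evalJet_apply]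
    rw [← evalJet_schoutenPoly hϱ ha, ← eight_mul_tetraPoly, evalJet_mul, h8,
      evalJet_tetraPoly hϱ ha]
    rfl
  refine ⟨fun ϱ a hϱ ha => isPoisson_nambu hϱ ha, ?_, coboundary, fun Y hY => ⟨fun h => ?_, ?_⟩⟩
  · refine ⟨MvPolynomial.C (1 / 8) * densityVelocity trivField, MvPolynomial.C (1 / 8) * -casimirVelocity trivField,
      fun ϱ a hϱ ha => ?_⟩
    funext i j
    rw [Pi.add_apply, Pi.add_apply, ← evalJet_sum_leviCivita _ _ hϱ ha, ← evalJet_tetraPoly hϱ ha]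
    congr 1
    have h8 : MvPolynomial.C (1 / 8) * 8 = (1 : DiffPoly) := by
      rw [← map_ofNat MvPolynomial.C 8, ← MvPolynomial.C_mul]
      norm_num
    rw [← one_mul (tetraPoly _ _ _), ← h8, mul_assoc, eight_mul_tetraPoly, schoutenPoly_eq,
      Finset.mul_sum]
    refine Finset.sum_congr rfl fun k _ => ?_
    rw [Derivation.leibniz, totalD_C, smul_zero, add_zero, smul_eq_mul]
    ring
  · have hz : ∀ i j, schoutenPoly (Y - trivField) i j = 0 := fun i j => by
      refine eq_zero_of_evalJet _ fun ϱ a hϱ ha => ?_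
      rw [schoutenPoly_sub, evalJet_sub, evalJet_schoutenPoly hϱ ha, evalJet_schoutenPoly hϱ ha,
        ← h ϱ a hϱ ha, ← coboundary ϱ a hϱ ha, sub_self]
    obtain ⟨H, hH⟩ := exists_eq_hamiltonianPoly
      (fun i => (MvPolynomial.weightedHomogeneousSubmodule ℝ rhoWeight 3).sub_mem (hY i)
        (isHomogeneousInRho_trivField i)) hz
    refine ⟨H, fun ϱ a hϱ ha => ?_⟩
    rw [← evalJet_hamiltonianPoly hϱ ha, ← hH]
    funext i
    simp [evalJetVec]
  · rintro ⟨H, hH⟩ ϱ a hϱ ha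
    have hY' : evalJetVec Y ϱ a = evalJetVec (trivField + hamiltonianPoly H) ϱ a := by
      rw [hH ϱ a hϱ ha, ← evalJet_hamiltonianPoly hϱ ha]
      funext i
      simp [evalJetVec]
    rw [coboundary ϱ a hϱ ha, hY']
    funext i j
    rw [← evalJet_schoutenPoly hϱ ha, ← evalJet_schoutenPoly hϱ ha]
    have hs := schoutenPoly_sub (trivField + hamiltonianPoly H) trivField i j
    rw [add_sub_cancel_left, schoutenPoly_hamiltonianPoly] at hs
    rw [← sub_eq_zero.1 hs.symm]
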